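/- **The graphs.** For positive integers $n,r,s,t$ let $G_{n,r,s,t}=(V,E,c)$ be the following weighted directed multigraph, where $[m]=\{1,\dots,m\}$ and $\epsilon=1/(rs)$. The vertices are a target $\mathsf t$, the vertices $u_i,w_i$ ($i\in[n]$), $a_{i,j,k}$ ($i\in[n],j\in[r],k\in[s]$) and $b_{i,j}$ ($i\in[n],j\in[rs]$); put $u_{n+1}=w_{n+1}=\mathsf t$, $a_{i,j,s+1}=b_{i,1}$ and $b_{i,rs+1}=w_{i+1}$. For all $i\in[n]$ the edges are: - $a_{i,j,k}\to a_{i,j,k+1}$ of cost $0$, and $t$ copies of the *zero-edge* $a_{i,j,k}\to u_{i+1}$ of cost $2^{2i+1}+(k-1)\epsilon$ ($j\in[r]$, $k\in[s]$); - $b_{i,j}\to b_{i,j+1}$ of cost $0$, and $t$ copies of the zero-edge $b_{i,j}\to u_{i+1}$ of cost $2^{2i+1}+1+(j-1)\epsilon$ ($j\in[rs]$); - $t$ copies of $u_i\to b_{i,1}$ of cost $0$, and $t$ copies of the zero-edge $u_i\to u_{i+1}$ of cost $2^{2i}$; - $t$ copies of $w_i\to a_{i,j,1}$ of cost $0$ for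 every $j\in[r]$, and $t$ copies of the zero-edge $w_i\to w_{i+1}$ of cost $2^{2i}$. **The algorithm.** A *tree* is a set $B\subseteq E$ that contains exactly one edge leaving each vertex other than $\mathsf t$ and along which $\mathsf t$ is reached from every vertex; $y_B(v)$ is the cost of the path in $B$ from $v$ to $\mathsf t$. An edge $e=(u,v)$ is an *improving switch* with respect to $B$ if $c(e)+y_B(v)<y_B(u)$, and $B[e]$ is the tree obtained from $B$ by replacing the edge that leaves $u$ by $e$. Given an injective $\sigma:E\to\mathbb N$, a set $F\subseteq E$ and a tree $B\subseteq F$, $\text{Random-Facet}^{1P}(F,B,\sigma)$ returns $B$ if $F=B$. Otherwise it takes the edge $e\in F\setminus B$ with the smallest $\sigma(e)$ and lets $B'$ be the tree returned by $\text{Random-Facet}^{1P}(F\setminus\{e\},B,\sigma)$. If $e$ is an improving switch with respect to $B'$, it performs this switch and returns the result of $\text{Random-Facet}^{1P}(F,B'[e],\sigma)$; otherwise it returns $B'$. For a tree $B_0$ let $g(B_0)$ be the expected total number of improving switches performed by $\text{Random-Facet}^{1P}(E,B_0,\sigma)$ (including those of all recursive calls) when $\sigma$ is a uniformly random bijection $E\to\{1,\dots,|E|\}$.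 **Theorem.** Let $\rho:\mathbb N\to\mathbb N$ satisfy $\rho(n)=\Theta(\log n)$ and $\rho(n)\ge 3\lceil\log n\rceil$ for all large $n$ (natural logarithm; for instance $\rho(n)=3\lceil\log n\rceil$ or $\rho(n)=3\lceil\log_2 n\rceil$). Consider $G_{n,r,s,t}$ with $r=s=t=\rho(n)$, and let $M=M(n)$ be its number of edges. Then $\sqrt n=\Theta\big(\sqrt M/\log^{3/2}M\big)$, and there is a constant $c>0$ such that for all sufficiently large $n$ and every tree $B_0$ of $G_{n,r,s,t}$ that consists of zero-edges only, $$g(B_0)\ \ge\ e^{c\sqrt n}\qquad\text{and}\qquad g(B_0)\ \ge\ e^{c\sqrt M/\log^{3/2}M}.$$ That is, $g(B_0)$ is at least $e^{\Omega(\sqrt n)}=e^{\Omega(\sqrt M/\log^{3/2}M)}$. -/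

import Mathlib

/-- A weighted directed multigraph with vertices `V`, edges `E` and a distinguished target. -/
structure WeightedDigraph (V E : Type*) where
  src : E → V
  dst : E → V
  cost : E → ℝ
  target : V

namespace WeightedDigraph

variable {V E : Type*} (G : WeightedDigraph V E)

/-- `G.PathCost B v d`: the edges of `B` contain a directed path from `v` to the target whose
total cost is `d`. If `B` is a tree, then there is exactly one such `d`, the value `y_B(v)`. -/
inductive PathCost (B : Finset E) : V → ℝ → Prop
  | nil : PathCost B G.target 0
  | cons (e : E) (d : ℝ) (he : e ∈ B) (hd : PathCost B (G.dst e) d) :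
      PathCost B (G.src e) (G.cost e + d)

/-- A tree directed towards the target: exactly one edge leaves every vertex other than the
target, no edge leaves the target, and the target is reached from every vertex. -/
def IsTree (B : Finset E) : Prop :=
  (∀ v, v ≠ G.target → ∃! e, e ∈ B ∧ G.src e = v) ∧
  (∀ e ∈ B, G.src e ≠ G.target) ∧
  ∀ v, ∃ d, G.PathCost B v d

/-- The edge `e = (u, v)` is an improving switch with respect to the tree `B`:
`c(e) + y_B(v) < y_B(u)`. -/
def IsImprovingSwitch (B : Finset E) (e : E) : Prop :=
  ∃ d d' : ℝ, G.PathCost B (G.dst e) d ∧ G.PathCost B (G.src e) d' ∧ G.cost e + d < d'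

open Classical in
/-- The tree `B[e]`: the edge of `B` leaving the source of `e` is replaced by `e`. -/
noncomputable def switch (B : Finset E) (e : E) : Finset E :=
  insert e (B.filter fun e' => G.src e' ≠ G.src e)

/-- `e` is the edge of `F \ B` with the smallest permutation index. -/
def IsFirst (σ : E → ℕ) (F B : Finset E) (e : E) : Prop :=
  e ∈ F ∧ e ∉ B ∧ ∀ e' ∈ F, e' ∉ B → σ e ≤ σ e'

open Classical in
/-- The one-permutation variant of the Random-Facet algorithm. `G.RandomFacet1P σ F B B' k` says
that the call with edge set `F`, tree `B` and permutation function `σ` terminates, returns the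
tree `B'`, and performs exactly `k` improving switches.
* If `F = B`, then `B` is returned.
* Otherwise let `e` be the edge of `F \ B` with the smallest index. The call on `F \ {e}` and `B`
  returns a tree `B'`. If `e` is not an improving switch with respect to `B'`, then `B'` is
  returned; otherwise the switch is performed and the algorithm is called on `F` and `B'[e]`. -/
inductive RandomFacet1P (σ : E → ℕ) : Finset E → Finset E → Finset E → ℕ → Prop
  | done (B : Finset E) : RandomFacet1P σ B B B 0
  | stay (F B B' : Finset E) (e : E) (k : ℕ) (he : IsFirst σ F B e)
      (h₁ : RandomFacet1P σ (F.erase e) B B' k) (hn : ¬ G.IsImprovingSwitch B' e) :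
      RandomFacet1P σ F B B' k
  | step (F B B' B'' : Finset E) (e : E) (k₁ k₂ : ℕ) (he : IsFirst σ F B e)
      (h₁ : RandomFacet1P σ (F.erase e) B B' k₁) (hi : G.IsImprovingSwitch B' e)
      (h₂ : RandomFacet1P σ F (G.switch B' e) B'' k₂) :
      RandomFacet1P σ F B B'' (k₁ + 1 + k₂)

/-- The algorithm is deterministic once the permutation function is fixed. -/
theorem RandomFacet1P.unique {σ : E → ℕ} (hσ : Function.Injective σ) {F B B₁ B₂ : Finset E}
    {k₁ k₂ : ℕ} (h₁ : G.RandomFacet1P σ F B B₁ k₁) (h₂ : G.RandomFacet1P σ F B B₂ k₂) :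
    B₁ = B₂ ∧ k₁ = k₂ := by
  have key : ∀ {F B : Finset E} {e e' : E}, IsFirst σ F B e → IsFirst σ F B e' → e = e' :=
    fun h h' => hσ (le_antisymm (h.2.2 _ h'.1 h'.2.1) (h'.2.2 _ h.1 h.2.1))
  induction h₁ generalizing B₂ k₂ with
  | done B =>
    cases h₂ with
    | done => exact ⟨rfl, rfl⟩
    | stay _ _ _ e _ he => exact absurd he.1 he.2.1
    | step _ _ _ _ e _ _ he => exact absurd he.1 he.2.1
  | stay F B B' e k he h₁ hn ih =>
    cases h₂ with
    | done => exact absurd he.1 he.2.1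
    | stay _ _ _ e' _ he' h₁' hn' =>
      obtain rfl := key he he'
      exact ih h₁'
    | step _ _ B'' _ e' _ _ he' h₁' hi' h₂' =>
      obtain rfl := key he he'
      obtain ⟨rfl, rfl⟩ := ih h₁'
      exact absurd hi' hn
  | step F B B' B'' e k l he h₁ hi h₃ ih₁ ih₂ =>
    cases h₂ with
    | done => exact absurd he.1 he.2.1
    | stay _ _ _ e' _ he' h₁' hn' =>
      obtain rfl := key he he'
      obtain ⟨rfl, rfl⟩ := ih₁ h₁'
      exact absurd hi hn'
    | step _ _ B₃ _ e' _ _ he' h₁' hi' h₂' =>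
      obtain rfl := key he he'
      obtain ⟨rfl, rfl⟩ := ih₁ h₁'
      obtain ⟨rfl, rfl⟩ := ih₂ h₂'
      exact ⟨rfl, rfl⟩

open Classical in
/-- The number of improving switches performed by the call with arguments `F`, `B`, `σ`.
It is set to `0`, the worst value for a lower bound, should the call not terminate. -/
noncomputable def numSwitches (σ : E → ℕ) (F B : Finset E) : ℕ :=
  if h : ∃ k, ∃ B', G.RandomFacet1P σ F B B' k then h.choose else 0

open Classical in
/-- The expected number of improving switches performed by the one-permutation variant of
Random-Facet on the whole graph from the initial tree `B₀`, when the permutation function is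
uniformly random among all the bijections of the edge set with an initial segment of `ℕ`.
(The algorithm only compares the indices, so it is immaterial that they start at `0`.) -/
noncomputable def expectedSwitches [Fintype E] (B₀ : Finset E) : ℝ :=
  (∑ σ : E ≃ Fin (Fintype.card E), (G.numSwitches (fun e => (σ e : ℕ)) Finset.univ B₀ : ℝ)) /
    (Fintype.card (E ≃ Fin (Fintype.card E)) : ℝ)

end WeightedDigraph

/-! ### The graphs `G_{n,r,s,t}`

All indices are zero-based: `i : Fin n` stands for the level `i + 1`, and similarly for the
positions `j`, `k` and for the copies `ℓ : Fin t` of a multi-edge. -/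

/-- The vertices of `G_{n,r,s,t}`. -/
inductive LBVertex (n r s : ℕ) : Type
  | target : LBVertex n r s
  | u (i : Fin n) : LBVertex n r s
  | w (i : Fin n) : LBVertex n r s
  | a (i : Fin n) (j : Fin r) (k : Fin s) : LBVertex n r s
  | b (i : Fin n) (j : Fin (r * s)) : LBVertex n r s

/-- The edges of `G_{n,r,s,t}`, named as follows: `a1 i j k` is `a¹_{i,j,k}`, `a0 i j k ℓ` is
`a^{0,ℓ}_{i,j,k}`, `b1 i j` is `b¹_{i,j}`, `b0 i j ℓ` is `b^{0,ℓ}_{i,j}`, `u1 i ℓ` is `u^{1,ℓ}_i`,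
`u0 i ℓ` is `u^{0,ℓ}_i`, `w1 i j ℓ` is `w^{j,ℓ}_i`, and `w0 i ℓ` is `w^{0,ℓ}_i`. -/
inductive LBEdge (n r s t : ℕ) : Type
  | a1 (i : Fin n) (j : Fin r) (k : Fin s) : LBEdge n r s t
  | a0 (i : Fin n) (j : Fin r) (k : Fin s) (l : Fin t) : LBEdge n r s t
  | b1 (i : Fin n) (j : Fin (r * s)) : LBEdge n r s t
  | b0 (i : Fin n) (j : Fin (r * s)) (l : Fin t) : LBEdge n r s t
  | u1 (i : Fin n) (l : Fin t) : LBEdge n r s t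
  | u0 (i : Fin n) (l : Fin t) : LBEdge n r s t
  | w1 (i : Fin n) (j : Fin r) (l : Fin t) : LBEdge n r s t
  | w0 (i : Fin n) (l : Fin t) : LBEdge n r s t
  deriving DecidableEq, Fintype

namespace LBVertex

variable {n r s : ℕ}

/-- The vertex `u_{i+1}`, which is the target if `i` is the last level. -/
def uNext (i : Fin n) : LBVertex n r s :=
  if h : (i : ℕ) + 1 < n then u ⟨i + 1, h⟩ else target

/-- The vertex `w_{i+1}`, which is the target if `i` is the last level. -/
def wNext (i : Fin n) : LBVertex n r s :=
  if h : (i : ℕ) + 1 < n then w ⟨i + 1, h⟩ else target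

/-- The vertex in (zero-based) position `j` of the `b`-path of level `i`, or `w_{i+1}` past the end
of the path. In particular `bAt i 0` is `b_{i,1}` whenever `r` and `s` are positive. -/
def bAt (i : Fin n) (j : ℕ) : LBVertex n r s :=
  if h : j < r * s then b i ⟨j, h⟩ else wNext i

/-- The vertex in (zero-based) position `k` of the `j`-th `a`-path of level `i`, or `b_{i,1}` past
the end of the path. -/
def aAt (i : Fin n) (j : Fin r) (k : ℕ) : LBVertex n r s :=
  if h : k < s then a i j ⟨k, h⟩ else bAt i 0

end LBVertex

namespace LBEdge

variable {n r s t : ℕ}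

/-- The vertex that an edge leaves. -/
def src : LBEdge n r s t → LBVertex n r s
  | a1 i j k => .a i j k
  | a0 i j k _ => .a i j k
  | b1 i j => .b i j
  | b0 i j _ => .b i j
  | u1 i _ => .u i
  | u0 i _ => .u i
  | w1 i _ _ => .w i
  | w0 i _ => .w i

/-- The vertex that an edge enters. -/
def dst : LBEdge n r s t → LBVertex n r s
  | a1 i j k => .aAt i j (k + 1)
  | a0 i _ _ _ => .uNext i
  | b1 i j => .bAt i (j + 1)
  | b0 i _ _ => .uNext i
  | u1 i _ => .bAt i 0
  | u0 i _ => .uNext i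
  | w1 i j _ => .aAt i j 0
  | w0 i _ => .wNext i

/-- The cost of an edge, with `ε = 1 / (r s)`. As `i`, `j`, `k` are zero-based, the factors
`j - 1` and `k - 1` of the one-based convention appear as `j` and `k`, and `2^{2i}`, `2^{2i+1}`
appear as `2^{2(i+1)}`, `2^{2(i+1)+1}`. -/
noncomputable def cost : LBEdge n r s t → ℝ
  | a1 _ _ _ => 0
  | a0 i _ k _ => 2 ^ (2 * ((i : ℕ) + 1) + 1) + (k : ℕ) * (1 / ((r : ℝ) * s))
  | b1 _ _ => 0
  | b0 i j _ => 2 ^ (2 * ((i : ℕ) + 1) + 1) + 1 + (j : ℕ) * (1 / ((r : ℝ) * s))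
  | u1 _ _ => 0
  | u0 i _ => 2 ^ (2 * ((i : ℕ) + 1))
  | w1 _ _ _ => 0
  | w0 i _ => 2 ^ (2 * ((i : ℕ) + 1))

/-- The zero-edges, i.e. the edges whose name has the superscript `0`. -/
def IsZeroEdge : LBEdge n r s t → Prop
  | a0 _ _ _ _ => True
  | b0 _ _ _ => True
  | u0 _ _ => True
  | w0 _ _ => True
  | _ => False

end LBEdge

/-- The graph `G_{n,r,s,t}`. -/
noncomputable def lbGraph (n r s t : ℕ) : WeightedDigraph (LBVertex n r s) (LBEdge n r s t) where
  src := LBEdge.src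
  dst := LBEdge.dst
  cost := LBEdge.cost
  target := LBVertex.target

/-- The number `M` of edges of `G_{n,r,s,t}`. -/
def lbNumEdges (n r s t : ℕ) : ℕ := Fintype.card (LBEdge n r s t)

open Filter Asymptotics

/-! The algorithm behaves like a randomized binary counter whose bits are the levels of the graph:
in an optimal tree for the edge set `F`, bit `i` is set exactly if `F` contains the whole `b`-path
of level `i`. Call level `l` *completed* when the first edge of its `b`-path in the order `σ` is
added, which happens after all its other edges are in place. If all edges `a¹` of some `a`-path of
level `l` come later in the order, then they are added after that; until the last of them is in
place, the path from `w_l` is more expensive than the path from `u_l` by `2^{2l}`, and this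
difference forces all lower levels to leave their `b`-paths, i.e. it resets their bits. Afterwards
the counter runs once more on the lower levels. Hence one plus the number of switches is at least
the number of sets of levels along which the completion times decrease.

By symmetry, `k` given levels have decreasing completion times with probability at least `1/k!`
(up to the failure of the events on `σ` used above), so the expected number of such sets is about
`∑ₖ C(n,k)/k!`, whose term with `k ≈ √n / 2` is exponential in `√n`. The events fail with small
probability because there are `t` copies of each zero-edge and logarithmically long paths. -/

namespace WeightedDigraph

variable {V E : Type*} {G : WeightedDigraph V E} {B B' F : Finset E} {σ : E → ℕ} {k : ℕ}

theorem PathCost.eq_target_or_exists_edge {v : V} {d : ℝ} (h : G.PathCost B v d) :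
    (v = G.target ∧ d = 0) ∨
      ∃ e ∈ B, G.src e = v ∧ ∃ d', G.PathCost B (G.dst e) d' ∧ d = G.cost e + d' := by
  cases h with
  | nil => exact Or.inl ⟨rfl, rfl⟩
  | cons e d he hd => exact Or.inr ⟨e, he, rfl, d, hd, rfl⟩

theorem IsTree.pathCost_unique (hB : G.IsTree B) {v : V} {d d' : ℝ}
    (h : G.PathCost B v d) (h' : G.PathCost B v d') : d = d' := by
  induction h generalizing d' with
  | nil =>
    rcases h'.eq_target_or_exists_edge with ⟨-, rfl⟩ | ⟨e, he, hs, -⟩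
    · rfl
    · exact absurd hs (hB.2.1 e he)
  | cons e d he hd ih =>
    rcases h'.eq_target_or_exists_edge with ⟨hs, -⟩ | ⟨e', he', hs, d'', hd'', rfl⟩
    · exact absurd hs (hB.2.1 e he)
    · obtain rfl : e' = e := (hB.1 _ (hB.2.1 e he)).unique ⟨he', hs⟩ ⟨he, rfl⟩
      rw [ih hd'']

variable (G) in
open Classical in
/-- The value `y_B(v)` of a vertex in a tree `B`, with junk value `0` if `B` does not contain a path
from `v` to the target. -/
noncomputable def val (B : Finset E) (v : V) : ℝ :=
  if h : ∃ d, G.PathCost B v d then h.choose else 0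

theorem IsTree.pathCost_val (hB : G.IsTree B) (v : V) : G.PathCost B v (G.val B v) := by
  have h := hB.2.2 v
  rw [val, dif_pos h]
  exact h.choose_spec

theorem IsTree.val_target (hB : G.IsTree B) : G.val B G.target = 0 :=
  hB.pathCost_unique (hB.pathCost_val _) .nil

theorem IsTree.val_src (hB : G.IsTree B) {e : E} (he : e ∈ B) :
    G.val B (G.src e) = G.cost e + G.val B (G.dst e) :=
  hB.pathCost_unique (hB.pathCost_val _) (.cons e _ he (hB.pathCost_val _))

theorem IsTree.isImprovingSwitch_iff (hB : G.IsTree B) {e : E} :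
    G.IsImprovingSwitch B e ↔ G.cost e + G.val B (G.dst e) < G.val B (G.src e) := by
  constructor
  · rintro ⟨d, d', hd, hd', h⟩
    rwa [hB.pathCost_unique (hB.pathCost_val _) hd, hB.pathCost_unique (hB.pathCost_val _) hd']
  · exact fun h => ⟨_, _, hB.pathCost_val _, hB.pathCost_val _, h⟩

/-- A rank function that decreases along all edges and witnesses that the graph is acyclic; moreover
no edge leaves the target. -/
structure IsRanking (G : WeightedDigraph V E) (rk : V → ℕ) : Prop where
  lt : ∀ e, rk (G.dst e) < rk (G.src e)
  src_ne_target : ∀ e, G.src e ≠ G.target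

variable {rk : V → ℕ}

theorem IsRanking.isTree (hG : G.IsRanking rk)
    (h : ∀ v, v ≠ G.target → ∃! e, e ∈ B ∧ G.src e = v) : G.IsTree B := by
  refine ⟨h, fun e _ => hG.src_ne_target e, fun v => ?_⟩
  induction hk : rk v using Nat.strong_induction_on generalizing v with
  | _ k ih =>
    by_cases hv : v = G.target
    · exact ⟨0, hv ▸ .nil⟩
    · obtain ⟨e, ⟨he, rfl⟩, -⟩ := h v hv
      obtain ⟨d, hd⟩ := ih _ (hk ▸ hG.lt e) _ rfl
      exact ⟨_, .cons e d he hd⟩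

theorem mem_switch {e e' : E} : e' ∈ G.switch B e ↔ e' = e ∨ e' ∈ B ∧ G.src e' ≠ G.src e := by
  simp [switch]

theorem self_mem_switch (e : E) : e ∈ G.switch B e := mem_switch.2 (Or.inl rfl)

theorem IsTree.switch (hB : G.IsTree B) (hG : G.IsRanking rk) (e : E) :
    G.IsTree (G.switch B e) := by
  refine hG.isTree fun v hv => ?_
  by_cases h : G.src e = v
  · refine ⟨e, ⟨self_mem_switch e, h⟩, ?_⟩
    rintro e' ⟨he', hs⟩
    rcases mem_switch.1 he' with rfl | ⟨-, hne⟩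
    · rfl
    · exact absurd (hs.trans h.symm) hne
  · obtain ⟨e₀, ⟨he₀, hs₀⟩, hu⟩ := hB.1 v hv
    refine ⟨e₀, ⟨mem_switch.2 (Or.inr ⟨he₀, fun h' => h (h'.symm.trans hs₀)⟩), hs₀⟩, ?_⟩
    rintro e' ⟨he', hs⟩
    rcases mem_switch.1 he' with rfl | ⟨hm, -⟩
    · exact absurd hs h
    · exact hu e' ⟨hm, hs⟩

theorem IsTree.val_switch_le (hB : G.IsTree B) (hG : G.IsRanking rk) {e : E}
    (he : G.IsImprovingSwitch B e) (v : V) : G.val (G.switch B e) v ≤ G.val B v := by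
  have hB' := hB.switch hG e
  rw [hB.isImprovingSwitch_iff] at he
  induction hk : rk v using Nat.strong_induction_on generalizing v with
  | _ k ih =>
    by_cases hv : v = G.target
    · rw [hv, hB.val_target, hB'.val_target]
    · obtain ⟨f, ⟨hf, rfl⟩, -⟩ := hB'.1 v hv
      have := ih _ (hk ▸ hG.lt f) _ rfl
      rw [hB'.val_src hf]
      rcases mem_switch.1 hf with rfl | ⟨hm, -⟩
      · linarith
      · rw [hB.val_src hm]
        linarith

theorem IsTree.val_switch_lt (hB : G.IsTree B) (hG : G.IsRanking rk) {e : E}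
    (he : G.IsImprovingSwitch B e) : G.val (G.switch B e) (G.src e) < G.val B (G.src e) := by
  have h := hB.val_switch_le hG he (G.dst e)
  rw [(hB.switch hG e).val_src (self_mem_switch e)]
  rw [hB.isImprovingSwitch_iff] at he
  linarith

open Classical in
/-- The edge set `F \ {e}` of the first recursive call of the algorithm. It names the `Finset.erase`
in the definition of `RandomFacet1P` together with its classical instance, so that it can be used on
types of edges that have another instance. -/
noncomputable abbrev without (F : Finset E) (e : E) : Finset E := F.erase e

open Classical in
theorem mem_without {e f : E} : f ∈ without F e ↔ f ≠ e ∧ f ∈ F := Finset.mem_erase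

open Classical in
theorem without_subset (F : Finset E) (e : E) : without F e ⊆ F := Finset.erase_subset e F

open Classical in
theorem card_without_lt {e : E} (he : e ∈ F) : (without F e).card < F.card :=
  Finset.card_erase_lt_of_mem he

/-- The tree `B` is contained in `F`, and no edge of `F` improves it. -/
structure IsOptimal (G : WeightedDigraph V E) (F B : Finset E) : Prop where
  isTree : G.IsTree B
  subset : B ⊆ F
  not_improving : ∀ e ∈ F, ¬ G.IsImprovingSwitch B e

theorem IsTree.isOptimal_self (hB : G.IsTree B) : G.IsOptimal B B where
  isTree := hB
  subset := subset_rfl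
  not_improving e he := by
    rw [hB.isImprovingSwitch_iff, hB.val_src he]
    exact lt_irrefl _

theorem IsOptimal.val_le (h : G.IsOptimal F B) {e : E} (he : e ∈ F) :
    G.val B (G.src e) ≤ G.cost e + G.val B (G.dst e) := by
  have := h.not_improving e he
  rwa [h.isTree.isImprovingSwitch_iff, not_lt] at this

theorem IsOptimal.of_without {e : E} (h : G.IsOptimal (without F e) B)
    (he : ¬ G.IsImprovingSwitch B e) : G.IsOptimal F B where
  isTree := h.isTree
  subset := h.subset.trans (without_subset F e)
  not_improving f hf := by
    by_cases hfe : f = e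
    · exact hfe ▸ he
    · exact h.not_improving f (mem_without.2 ⟨hfe, hf⟩)

theorem RandomFacet1P.subset (h : G.RandomFacet1P σ F B B' k) : B ⊆ F := by
  induction h with
  | done => exact subset_rfl
  | stay F _ _ e _ _ _ _ ih => exact ih.trans (without_subset F e)
  | step F _ _ _ e _ _ _ _ _ _ ih₁ => exact ih₁.trans (without_subset F e)

theorem RandomFacet1P.isOptimal (hG : G.IsRanking rk) (h : G.RandomFacet1P σ F B B' k)
    (hB : G.IsTree B) : G.IsOptimal F B' := by
  induction h with
  | done => exact hB.isOptimal_self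
  | stay _ _ _ _ _ _ _ hn ih => exact (ih hB).of_without hn
  | step _ _ _ _ e _ _ _ _ _ _ ih₁ ih₂ => exact ih₂ ((ih₁ hB).isTree.switch hG e)

theorem RandomFacet1P.val_le (hG : G.IsRanking rk) (h : G.RandomFacet1P σ F B B' k)
    (hB : G.IsTree B) (v : V) : G.val B' v ≤ G.val B v := by
  induction h with
  | done => exact le_rfl
  | stay _ _ _ _ _ _ _ _ ih => exact ih hB
  | step _ _ _ _ e _ _ _ h₁ hi _ ih₁ ih₂ =>
    have hB' := (h₁.isOptimal hG hB).isTree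
    exact (ih₂ (hB'.switch hG e)).trans ((hB'.val_switch_le hG hi v).trans (ih₁ hB))

theorem exists_isFirst (hBF : B ⊆ F) (hne : F ≠ B) : ∃ e, IsFirst σ F B e := by
  classical
  have : (F \ B).Nonempty := Finset.sdiff_nonempty.2 fun h => hne (h.antisymm hBF)
  obtain ⟨e, he, hmin⟩ := Finset.exists_min_image _ σ this
  rw [Finset.mem_sdiff] at he
  exact ⟨e, he.1, he.2, fun e' h h' => hmin e' (Finset.mem_sdiff.2 ⟨h, h'⟩)⟩

theorem IsFirst.subset_without {e : E} (he : IsFirst σ F B e) (hBF : B ⊆ F) : B ⊆ without F e :=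
  fun _ hf => mem_without.2 ⟨ne_of_mem_of_not_mem hf he.2.1, hBF hf⟩

theorem IsOptimal.switch_subset {e : E} (h : G.IsOptimal (without F e) B) (he : e ∈ F) :
    G.switch B e ⊆ F := by
  intro f hf
  rcases mem_switch.1 hf with rfl | ⟨hm, -⟩
  · exact he
  · exact without_subset F e (h.subset hm)

theorem wellFounded_sum_val_lt [Fintype E] :
    WellFounded fun B₁ B₂ : Finset E => ∑ e, G.val B₁ (G.src e) < ∑ e, G.val B₂ (G.src e) :=
  have : IsTrans (Finset E) fun B₁ B₂ => ∑ e, G.val B₁ (G.src e) < ∑ e, G.val B₂ (G.src e) :=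
    ⟨fun _ _ _ => lt_trans⟩
  have : Std.Irrefl fun B₁ B₂ : Finset E =>
      ∑ e, G.val B₁ (G.src e) < ∑ e, G.val B₂ (G.src e) := ⟨fun _ => lt_irrefl _⟩
  Finite.wellFounded_of_trans_of_irrefl _

theorem IsRanking.exists_randomFacet1P [Finite E] (hG : G.IsRanking rk) (σ : E → ℕ)
    (hBF : B ⊆ F) (hB : G.IsTree B) : ∃ B' k, G.RandomFacet1P σ F B B' k := by
  cases nonempty_fintype E
  induction hc : F.card using Nat.strong_induction_on generalizing F B with
  | _ c ihF =>
    induction B using (wellFounded_sum_val_lt (G := G)).induction with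
    | _ B ihB =>
      by_cases hne : F = B
      · subst hne
        exact ⟨F, 0, .done F⟩
      obtain ⟨e, he⟩ := exists_isFirst (σ := σ) hBF hne
      obtain ⟨B', k, h₁⟩ := ihF _ (hc ▸ card_without_lt he.1) (he.subset_without hBF) hB rfl
      by_cases hi : G.IsImprovingSwitch B' e
      · have hB' := h₁.isOptimal hG hB
        have hlt : ∑ f, G.val (G.switch B' e) (G.src f) < ∑ f, G.val B (G.src f) :=
          Finset.sum_lt_sum
            (fun f _ => (hB'.isTree.val_switch_le hG hi _).trans (h₁.val_le hG hB _))
            ⟨e, Finset.mem_univ e, (hB'.isTree.val_switch_lt hG hi).trans_le (h₁.val_le hG hB _)⟩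
        obtain ⟨B'', k', h₂⟩ := ihB _ hlt (hB'.switch_subset he.1) (hB'.isTree.switch hG e)
        exact ⟨B'', _, .step F B B' B'' e k k' he h₁ hi h₂⟩
      · exact ⟨B', k, .stay F B B' e k he h₁ hi⟩

theorem exists_randomFacet1P_numSwitches (h : ∃ B' k, G.RandomFacet1P σ F B B' k) :
    ∃ B', G.RandomFacet1P σ F B B' (G.numSwitches σ F B) := by
  have h' : ∃ k, ∃ B', G.RandomFacet1P σ F B B' k := exists_comm.1 h
  rw [numSwitches, dif_pos h']
  exact h'.choose_spec

open scoped BigOperators in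
theorem expectedSwitches_eq_expect [Fintype E] [DecidableEq E] :
    G.expectedSwitches B =
      𝔼 σ : E ≃ Fin (Fintype.card E), (G.numSwitches (fun e => σ e) Finset.univ B : ℝ) := by
  rw [expectedSwitches, Fintype.expect_eq_sum_div_card]
  congr!

end WeightedDigraph

namespace LBVertex

variable {n r s : ℕ}

/-- A rank function that decreases along the edges of `G_{n,r,s,t}`. Every level occupies
`r s + s + 2` consecutive ranks: those of the `b`-path, those of the `a`-paths, and the rank of `u`
and `w`. -/
def rank : LBVertex n r s → ℕ
  | target => 0
  | u i => (n - 1 - i) * (r * s + s + 2) + (r * s + s + 1)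
  | w i => (n - 1 - i) * (r * s + s + 2) + (r * s + s + 1)
  | a i _ k => (n - 1 - i) * (r * s + s + 2) + (r * s + (s - k))
  | b i j => (n - 1 - i) * (r * s + s + 2) + (r * s - j)

theorem rank_next_level_le {i : ℕ} (h : i + 1 < n) :
    (n - 1 - (i + 1)) * (r * s + s + 2) + (r * s + s + 1) ≤ (n - 1 - i) * (r * s + s + 2) := by
  have : n - 1 - i = n - 1 - (i + 1) + 1 := by omega
  rw [this, add_mul]
  omega

theorem rank_uNext_le (i : Fin n) :
    (uNext i : LBVertex n r s).rank ≤ (n - 1 - i) * (r * s + s + 2) := by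
  unfold uNext
  split_ifs with h
  · exact rank_next_level_le h
  · exact Nat.zero_le _

theorem rank_wNext_le (i : Fin n) :
    (wNext i : LBVertex n r s).rank ≤ (n - 1 - i) * (r * s + s + 2) := by
  unfold wNext
  split_ifs with h
  · exact rank_next_level_le h
  · exact Nat.zero_le _

theorem rank_bAt_le (i : Fin n) (m : ℕ) :
    (bAt i m : LBVertex n r s).rank ≤ (n - 1 - i) * (r * s + s + 2) + (r * s - m) := by
  unfold bAt
  split_ifs with h
  · exact le_rfl
  · exact (rank_wNext_le i).trans (Nat.le_add_right _ _)

theorem rank_aAt_le (i : Fin n) (j : Fin r) (m : ℕ) :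
    (aAt i j m : LBVertex n r s).rank ≤ (n - 1 - i) * (r * s + s + 2) + (r * s + (s - m)) := by
  unfold aAt
  split_ifs with h
  · exact le_rfl
  · exact (rank_bAt_le i 0).trans (by omega)

/-- The vertex `u_i`, which is the target if `i` is past the last level. -/
def uAt (i : ℕ) : LBVertex n r s := if h : i < n then u ⟨i, h⟩ else target

/-- The vertex `w_i`, which is the target if `i` is past the last level. -/
def wAt (i : ℕ) : LBVertex n r s := if h : i < n then w ⟨i, h⟩ else target

theorem uAt_coe (i : Fin n) : (uAt (i : ℕ) : LBVertex n r s) = u i := by simp [uAt]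

theorem wAt_coe (i : Fin n) : (wAt (i : ℕ) : LBVertex n r s) = w i := by simp [wAt]

theorem uAt_last : (uAt n : LBVertex n r s) = target := by simp [uAt]

theorem wAt_last : (wAt n : LBVertex n r s) = target := by simp [wAt]

theorem bAt_of_lt (i : Fin n) {m : ℕ} (hm : m < r * s) :
    (bAt i m : LBVertex n r s) = b i ⟨m, hm⟩ := by
  simp [bAt, hm]

theorem aAt_of_lt (i : Fin n) (j : Fin r) {m : ℕ} (hm : m < s) :
    (aAt i j m : LBVertex n r s) = a i j ⟨m, hm⟩ := by
  simp [aAt, hm]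

theorem bAt_length (i : Fin n) : (bAt i (r * s) : LBVertex n r s) = wAt (i + 1) := by
  simp [bAt, wNext, wAt]

theorem aAt_length (i : Fin n) (j : Fin r) : (aAt i j s : LBVertex n r s) = bAt i 0 := by
  simp [aAt]

end LBVertex

theorem lbGraph_isRanking {n r s t : ℕ} : (lbGraph n r s t).IsRanking LBVertex.rank where
  lt e := by
    cases e with
    | a1 i j k => exact (LBVertex.rank_aAt_le i j (k + 1)).trans_lt (by
        simp only [lbGraph, LBEdge.src, LBVertex.rank]; omega)
    | a0 i j k l => exact (LBVertex.rank_uNext_le i).trans_lt (by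
        simp only [lbGraph, LBEdge.src, LBVertex.rank]; omega)
    | b1 i j => exact (LBVertex.rank_bAt_le i (j + 1)).trans_lt (by
        simp only [lbGraph, LBEdge.src, LBVertex.rank]; omega)
    | b0 i j l => exact (LBVertex.rank_uNext_le i).trans_lt (by
        simp only [lbGraph, LBEdge.src, LBVertex.rank]; omega)
    | u1 i l => exact (LBVertex.rank_bAt_le i 0).trans_lt (by
        simp only [lbGraph, LBEdge.src, LBVertex.rank]; omega)
    | u0 i l => exact (LBVertex.rank_uNext_le i).trans_lt (by
        simp only [lbGraph, LBEdge.src, LBVertex.rank]; omega)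
    | w1 i j l => exact (LBVertex.rank_aAt_le i j 0).trans_lt (by
        simp only [lbGraph, LBEdge.src, LBVertex.rank]; omega)
    | w0 i l => exact (LBVertex.rank_wNext_le i).trans_lt (by
        simp only [lbGraph, LBEdge.src, LBVertex.rank]; omega)
  src_ne_target e := by cases e <;> simp [lbGraph, LBEdge.src]

/-- The cost `2^{2i}` of the zero-edges that leave `u_i` and `w_i`; as `i` is zero-based, the
exponent is `2(i+1)`. -/
noncomputable def levelCost (i : ℕ) : ℝ := 2 ^ (2 * (i + 1))

theorem levelCost_succ (i : ℕ) : levelCost (i + 1) = 4 * levelCost i := by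
  unfold levelCost
  ring

theorem four_le_levelCost (i : ℕ) : 4 ≤ levelCost i := by
  unfold levelCost
  calc (4 : ℝ) = 2 ^ 2 := by norm_num
    _ ≤ 2 ^ (2 * (i + 1)) := pow_le_pow_right₀ one_le_two (by omega)

theorem two_pow_eq_two_mul_levelCost (i : ℕ) :
    (2 : ℝ) ^ (2 * (i + 1) + 1) = 2 * levelCost i := by
  unfold levelCost
  ring

/-- The surcharge `mε`, with `ε = 1 / (r s)`, for leaving an `a`-path or a `b`-path at its
zero-based position `m`. -/
noncomputable def surcharge (r s m : ℕ) : ℝ := m * (1 / ((r : ℝ) * s))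

theorem surcharge_zero (r s : ℕ) : surcharge r s 0 = 0 := by simp [surcharge]

theorem surcharge_mono (r s : ℕ) : Monotone (surcharge r s) := fun m m' h => by
  unfold surcharge
  gcongr

theorem surcharge_nonneg (r s m : ℕ) : 0 ≤ surcharge r s m :=
  (surcharge_zero r s).ge.trans (surcharge_mono r s (Nat.zero_le m))

theorem surcharge_lt_succ {r s : ℕ} (hrs : 0 < r * s) (m : ℕ) :
    surcharge r s m < surcharge r s (m + 1) := by
  have : (0 : ℝ) < r * s := by exact_mod_cast hrs
  unfold surcharge
  gcongr
  exact m.lt_succ_self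

theorem surcharge_le_one {r s m : ℕ} (hm : m ≤ r * s) : surcharge r s m ≤ 1 := by
  unfold surcharge
  rw [mul_one_div]
  exact div_le_one_of_le₀ (by exact_mod_cast hm) (by positivity)

theorem le_of_forall_eq_succ_or_le {α : Type*} [Preorder α] {x V : ℕ → α} {L : ℕ}
    (hV : Monotone V) (hx : ∀ m < L, x m = x (m + 1) ∨ V m ≤ x m) (hL : V L ≤ x L) {m : ℕ}
    (hm : m ≤ L) : V m ≤ x m := by
  induction hm using Nat.decreasingInduction with
  | self => exact hL
  | of_succ m hm ih =>
    rcases hx m hm with h | h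
    · exact h ▸ (hV m.le_succ).trans ih
    · exact h

/-- The groups of parallel edges of `G_{n,r,s,t}`, each named after its edges. -/
inductive LBBundle (n r s : ℕ) : Type
  | a0 (i : Fin n) (j : Fin r) (k : Fin s) : LBBundle n r s
  | b0 (i : Fin n) (j : Fin (r * s)) : LBBundle n r s
  | u1 (i : Fin n) : LBBundle n r s
  | u0 (i : Fin n) : LBBundle n r s
  | w1 (i : Fin n) (j : Fin r) : LBBundle n r s
  | w0 (i : Fin n) : LBBundle n r s
  deriving Fintype

namespace LBBundle

variable {n r s t : ℕ}

/-- The `l`-th edge of a group of parallel edges. -/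
def copy : LBBundle n r s → Fin t → LBEdge n r s t
  | a0 i j k, l => .a0 i j k l
  | b0 i j, l => .b0 i j l
  | u1 i, l => .u1 i l
  | u0 i, l => .u0 i l
  | w1 i j, l => .w1 i j l
  | w0 i, l => .w0 i l

theorem copy_injective (g : LBBundle n r s) :
    Function.Injective (g.copy : Fin t → LBEdge n r s t) := by
  intro l l' h
  cases g <;> simpa [copy] using h

end LBBundle

namespace lbGraph

open LBVertex LBEdge

variable {n r s t : ℕ} {F F' T : Finset (LBEdge n r s t)}

/-- The value `y_T(v)` in `G_{n,r,s,t}`. -/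
noncomputable abbrev y (T : Finset (LBEdge n r s t)) (v : LBVertex n r s) : ℝ :=
  (lbGraph n r s t).val T v

theorem y_u (hT : (lbGraph n r s t).IsTree T) (i : Fin n) :
    y T (uAt i) = y T (bAt i 0) ∨ y T (uAt i) = levelCost i + y T (uAt (i + 1)) := by
  rw [uAt_coe]
  obtain ⟨e, ⟨he, hs⟩, -⟩ := hT.1 (.u i) (by simp [lbGraph])
  have h := hT.val_src he
  cases e <;> simp only [lbGraph, src, reduceCtorEq, u.injEq] at hs <;> subst hs
  · exact Or.inl (h.trans (zero_add _))
  · exact Or.inr h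

theorem y_w (hT : (lbGraph n r s t).IsTree T) (i : Fin n) :
    (∃ j, y T (wAt i) = y T (aAt i j 0)) ∨ y T (wAt i) = levelCost i + y T (wAt (i + 1)) := by
  rw [wAt_coe]
  obtain ⟨e, ⟨he, hs⟩, -⟩ := hT.1 (.w i) (by simp [lbGraph])
  have h := hT.val_src he
  cases e <;> simp only [lbGraph, src, reduceCtorEq, w.injEq] at hs <;> subst hs
  · exact Or.inl ⟨_, h.trans (zero_add _)⟩
  · exact Or.inr h

theorem y_b (hT : (lbGraph n r s t).IsTree T) (i : Fin n) {m : ℕ} (hm : m < r * s) :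
    (b1 i ⟨m, hm⟩ ∈ T ∧ y T (bAt i m) = y T (bAt i (m + 1))) ∨
      (b1 i ⟨m, hm⟩ ∉ T ∧
        y T (bAt i m) = 2 * levelCost i + 1 + surcharge r s m + y T (uAt (i + 1))) := by
  rw [bAt_of_lt i hm, ← two_pow_eq_two_mul_levelCost]
  obtain ⟨e, ⟨he, hs⟩, hu⟩ := hT.1 (.b i ⟨m, hm⟩) (by simp [lbGraph])
  have h := hT.val_src he
  cases e <;> simp only [lbGraph, src, reduceCtorEq, b.injEq] at hs <;> obtain ⟨rfl, rfl⟩ := hs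
  · exact Or.inl ⟨he, h.trans (zero_add _)⟩
  · exact Or.inr ⟨fun h' => (nomatch hu _ ⟨h', rfl⟩), h⟩

theorem y_a (hT : (lbGraph n r s t).IsTree T) (i : Fin n) (j : Fin r) {m : ℕ} (hm : m < s) :
    (a1 i j ⟨m, hm⟩ ∈ T ∧ y T (aAt i j m) = y T (aAt i j (m + 1))) ∨
      (a1 i j ⟨m, hm⟩ ∉ T ∧
        y T (aAt i j m) = 2 * levelCost i + surcharge r s m + y T (uAt (i + 1))) := by
  rw [aAt_of_lt i j hm, ← two_pow_eq_two_mul_levelCost]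
  obtain ⟨e, ⟨he, hs⟩, hu⟩ := hT.1 (.a i j ⟨m, hm⟩) (by simp [lbGraph])
  have h := hT.val_src he
  cases e <;> simp only [lbGraph, src, reduceCtorEq, a.injEq] at hs <;>
    obtain ⟨rfl, rfl, rfl⟩ := hs
  · exact Or.inl ⟨he, h.trans (zero_add _)⟩
  · exact Or.inr ⟨fun h' => (nomatch hu _ ⟨h', rfl⟩), h⟩

theorem le_y_bAt (hT : (lbGraph n r s t).IsTree T) (i : Fin n) {V : ℕ → ℝ} (hV : Monotone V)
    (hle : ∀ m, V m ≤ 2 * levelCost i + 1 + surcharge r s m + y T (uAt (i + 1))) {L : ℕ}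
    (hL : L ≤ r * s) (hVL : V L ≤ y T (bAt i L)) {m : ℕ} (hm : m ≤ L) : V m ≤ y T (bAt i m) :=
  le_of_forall_eq_succ_or_le (x := fun m => y T (bAt i m)) hV
    (fun m hm => (y_b hT i (hm.trans_le hL)).imp And.right fun h => (hle m).trans h.2.ge) hVL hm

theorem le_y_aAt (hT : (lbGraph n r s t).IsTree T) (i : Fin n) (j : Fin r) {V : ℕ → ℝ}
    (hV : Monotone V) (hle : ∀ m, V m ≤ 2 * levelCost i + surcharge r s m + y T (uAt (i + 1)))
    {L : ℕ} (hL : L ≤ s) (hVL : V L ≤ y T (aAt i j L)) {m : ℕ} (hm : m ≤ L) :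
    V m ≤ y T (aAt i j m) :=
  le_of_forall_eq_succ_or_le (x := fun m => y T (aAt i j m)) hV
    (fun m hm => (y_a hT i j (hm.trans_le hL)).imp And.right fun h => (hle m).trans h.2.ge) hVL hm

theorem monotone_add_surcharge_add (r s : ℕ) (x z : ℝ) :
    Monotone fun m => x + surcharge r s m + z :=
  ((surcharge_mono r s).const_add x).add_const z

theorem le_y_bAt_of_le_y_wAt (hT : (lbGraph n r s t).IsTree T) (i : Fin n)
    (hw : 2 * levelCost i + 2 + y T (uAt (i + 1)) ≤ y T (wAt (i + 1))) {m : ℕ} (hm : m ≤ r * s) :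
    2 * levelCost i + 1 + surcharge r s m + y T (uAt (i + 1)) ≤ y T (bAt i m) := by
  refine le_y_bAt hT i (monotone_add_surcharge_add r s _ _) (fun _ => le_rfl) le_rfl ?_ hm
  have := surcharge_le_one (le_refl (r * s))
  rw [bAt_length]
  linarith

theorem le_y_bAt_zero_of_notMem (hT : (lbGraph n r s t).IsTree T) (i : Fin n) {j : Fin (r * s)}
    (hj : b1 i j ∉ T) : 2 * levelCost i + 1 + y T (uAt (i + 1)) ≤ y T (bAt i 0) := by
  refine le_y_bAt hT i (V := fun _ => _) monotone_const (fun m => ?_) j.2.le ?_ (Nat.zero_le _)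
  · linarith [surcharge_nonneg r s m]
  · rcases y_b hT i j.2 with ⟨h, -⟩ | ⟨-, h⟩
    · exact absurd h hj
    · linarith [surcharge_nonneg r s j]

theorem le_y_aAt_zero_of_notMem (hT : (lbGraph n r s t).IsTree T) (i : Fin n) {j : Fin r}
    {k : Fin s} (hk : a1 i j k ∉ T) : 2 * levelCost i + y T (uAt (i + 1)) ≤ y T (aAt i j 0) := by
  refine le_y_aAt hT i j (V := fun _ => _) monotone_const (fun m => ?_) k.2.le ?_ (Nat.zero_le _)
  · linarith [surcharge_nonneg r s m]
  · rcases y_a hT i j k.2 with ⟨h, -⟩ | ⟨-, h⟩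
    · exact absurd h hk
    · linarith [surcharge_nonneg r s k]

theorem le_y_aAt_of_le_y_bAt (hT : (lbGraph n r s t).IsTree T) (i : Fin n)
    (hb : 2 * levelCost i + 1 + y T (uAt (i + 1)) ≤ y T (bAt i 0)) (j : Fin r) {m : ℕ}
    (hm : m ≤ s) : 2 * levelCost i + surcharge r s m + y T (uAt (i + 1)) ≤ y T (aAt i j m) := by
  refine le_y_aAt hT i j (monotone_add_surcharge_add r s _ _) (fun _ => le_rfl) le_rfl ?_ hm
  have := surcharge_le_one (Nat.le_mul_of_pos_left s j.pos)
  rw [aAt_length]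
  linarith

theorem le_y_aAt_zero_of_le_y_bAt (hT : (lbGraph n r s t).IsTree T) (i : Fin n)
    (hb : 2 * levelCost i + 1 + y T (uAt (i + 1)) ≤ y T (bAt i 0)) (j : Fin r) :
    2 * levelCost i + y T (uAt (i + 1)) ≤ y T (aAt i j 0) := by
  simpa only [surcharge_zero, add_zero] using le_y_aAt_of_le_y_bAt hT i hb j (Nat.zero_le s)

theorem y_uAt_succ_le_y_bAt_zero (hT : (lbGraph n r s t).IsTree T) (i : Fin n)
    (hw : y T (uAt (i + 1)) ≤ y T (wAt (i + 1))) : y T (uAt (i + 1)) ≤ y T (bAt i 0) := by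
  refine le_y_bAt hT i (V := fun _ => _) monotone_const (fun m => ?_) le_rfl ?_ (Nat.zero_le _)
  · linarith [surcharge_nonneg r s m, four_le_levelCost i]
  · rwa [bAt_length]

theorem y_uAt_succ_le_y_aAt_zero (hT : (lbGraph n r s t).IsTree T) (i : Fin n) (j : Fin r)
    (hb : y T (uAt (i + 1)) ≤ y T (bAt i 0)) : y T (uAt (i + 1)) ≤ y T (aAt i j 0) := by
  refine le_y_aAt hT i j (V := fun _ => _) monotone_const (fun m => ?_) le_rfl ?_ (Nat.zero_le _)
  · linarith [surcharge_nonneg r s m, four_le_levelCost i]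
  · rwa [aAt_length]

/-- Every group of parallel edges has an edge in `F`. Then optimal trees in `F` have the same values
as if all zero-edges and all edges leaving `u_i` and `w_i` were in `F`. -/
def Available (F : Finset (LBEdge n r s t)) : Prop := ∀ g : LBBundle n r s, ∃ l, g.copy l ∈ F

/-- The `b`-path of level `i` is contained in `F`. -/
def BChain (F : Finset (LBEdge n r s t)) (i : Fin n) : Prop := ∀ j, b1 i j ∈ F

/-- The `j`-th `a`-path of level `i` is contained in `F`. -/
def AChain (F : Finset (LBEdge n r s t)) (i : Fin n) (j : Fin r) : Prop := ∀ k, a1 i j k ∈ F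

theorem BChain.mono {i : Fin n} (h : BChain F i) (hF : F ⊆ F') : BChain F' i := fun j => hF (h j)

section Optimal

variable (hT : (lbGraph n r s t).IsOptimal F T)

include hT

theorem y_bAt_le_of_bChain {i : Fin n} (h : BChain F i) {m : ℕ} (hm : m ≤ r * s) :
    y T (bAt i m) ≤ y T (wAt (i + 1)) := by
  induction hm using Nat.decreasingInduction with
  | self => rw [bAt_length]
  | of_succ m hm ih =>
    rw [bAt_of_lt i hm]
    exact ((hT.val_le (h ⟨m, hm⟩)).trans (zero_add _).le).trans ih

theorem y_aAt_le_of_aChain {i : Fin n} {j : Fin r} (h : AChain F i j) {m : ℕ} (hm : m ≤ s) :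
    y T (aAt i j m) ≤ y T (bAt i 0) := by
  induction hm using Nat.decreasingInduction with
  | self => rw [aAt_length]
  | of_succ m hm ih =>
    rw [aAt_of_lt i j hm]
    exact ((hT.val_le (h ⟨m, hm⟩)).trans (zero_add _).le).trans ih

theorem bChain_of_y_u_eq_y_w {i : Fin n} (h : BChain F i)
    (hi : y T (uAt (i + 1)) = y T (wAt (i + 1))) : BChain T i := by
  intro j
  rcases y_b hT.isTree i j.2 with ⟨hj, -⟩ | ⟨-, hj⟩
  · exact hj
  · have := y_bAt_le_of_bChain hT h j.2.le
    linarith [surcharge_nonneg r s j, four_le_levelCost i]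

theorem aChain_of_y_u_eq_y_w {i : Fin n} {j : Fin r} (hj : AChain F i j) (h : BChain F i)
    (hi : y T (uAt (i + 1)) = y T (wAt (i + 1))) : AChain T i j := by
  intro k
  rcases y_a hT.isTree i j k.2 with ⟨hk, -⟩ | ⟨-, hk⟩
  · exact hk
  · have h₁ := y_aAt_le_of_aChain hT hj k.2.le
    have h₂ := y_bAt_le_of_bChain hT h (Nat.zero_le _)
    linarith [surcharge_nonneg r s k, four_le_levelCost i]

variable (hF : Available F)

include hF

theorem y_u_le_levelCost_add (i : Fin n) : y T (uAt i) ≤ levelCost i + y T (uAt (i + 1)) := by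
  obtain ⟨l, hl⟩ := hF (.u0 i)
  rw [uAt_coe]
  exact hT.val_le hl

theorem y_u_le_y_b (i : Fin n) : y T (uAt i) ≤ y T (bAt i 0) := by
  obtain ⟨l, hl⟩ := hF (.u1 i)
  rw [uAt_coe]
  exact (hT.val_le hl).trans (zero_add _).le

theorem y_w_le_levelCost_add (i : Fin n) : y T (wAt i) ≤ levelCost i + y T (wAt (i + 1)) := by
  obtain ⟨l, hl⟩ := hF (.w0 i)
  rw [wAt_coe]
  exact hT.val_le hl

theorem y_w_le_y_a (i : Fin n) (j : Fin r) : y T (wAt i) ≤ y T (aAt i j 0) := by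
  obtain ⟨l, hl⟩ := hF (.w1 i j)
  rw [wAt_coe]
  exact (hT.val_le hl).trans (zero_add _).le

theorem y_b_le (i : Fin n) (j : Fin (r * s)) :
    y T (bAt i j) ≤ 2 * levelCost i + 1 + surcharge r s j + y T (uAt (i + 1)) := by
  obtain ⟨l, hl⟩ := hF (.b0 i j)
  rw [bAt_of_lt i j.2, ← two_pow_eq_two_mul_levelCost]
  exact hT.val_le hl

theorem y_a_le (i : Fin n) (j : Fin r) (k : Fin s) :
    y T (aAt i j k) ≤ 2 * levelCost i + surcharge r s k + y T (uAt (i + 1)) := by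
  obtain ⟨l, hl⟩ := hF (.a0 i j k)
  rw [aAt_of_lt i j k.2, ← two_pow_eq_two_mul_levelCost]
  exact hT.val_le hl

/-- The surcharges make it cheaper to leave an `a`-path now than after one more step. -/
theorem a1_notMem_of_not_bChain {i : Fin n} (h : ¬ BChain F i) (j : Fin r) (k : Fin s) :
    a1 i j k ∉ T := by
  obtain ⟨j', hj'⟩ := not_forall.1 h
  have hb := le_y_bAt_zero_of_notMem hT.isTree i fun h => hj' (hT.subset h)
  rcases y_a hT.isTree i j k.2 with ⟨-, hk⟩ | ⟨hk, -⟩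
  · have h₁ := le_y_aAt_of_le_y_bAt hT.isTree i hb j (m := k + 1) k.2
    have h₂ := y_a_le hT hF i j k
    linarith [surcharge_lt_succ (Nat.mul_pos j.pos k.pos) k]
  · exact hk

theorem b1_notMem_of_le_y_wAt {i : Fin n}
    (hw : 2 * levelCost i + 2 + y T (uAt (i + 1)) ≤ y T (wAt (i + 1))) (j : Fin (r * s)) :
    b1 i j ∉ T := by
  rcases y_b hT.isTree i j.2 with ⟨-, hj⟩ | ⟨hj, -⟩
  · have h₁ := le_y_bAt_of_le_y_wAt hT.isTree i hw (m := j + 1) j.2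
    have h₂ := y_b_le hT hF i j
    linarith [surcharge_lt_succ j.pos j]
  · exact hj

theorem y_u_eq_and_y_w_eq_of_bChain {i : Fin n} {j : Fin r}
    (hi : y T (uAt (i + 1)) = y T (wAt (i + 1))) (hb : BChain F i) (ha : AChain F i j) :
    y T (uAt i) = y T (uAt (i + 1)) ∧ y T (wAt i) = y T (uAt (i + 1)) := by
  have h4 := four_le_levelCost i
  have hb₀ : y T (bAt i 0) = y T (uAt (i + 1)) :=
    ((y_bAt_le_of_bChain hT hb (Nat.zero_le _)).trans hi.ge).antisymm
      (y_uAt_succ_le_y_bAt_zero hT.isTree i hi.le)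
  constructor
  · have := y_u_le_y_b hT hF i
    rcases y_u hT.isTree i with h | h <;> linarith
  · have h₁ := y_w_le_y_a hT hF i j
    have h₂ := y_aAt_le_of_aChain hT ha (Nat.zero_le _)
    rcases y_w hT.isTree i with ⟨j', h⟩ | h
    · have := y_uAt_succ_le_y_aAt_zero hT.isTree i j' hb₀.ge
      linarith
    · linarith

theorem y_u_eq_and_y_w_eq_of_not_bChain {i : Fin n}
    (hi : y T (uAt (i + 1)) = y T (wAt (i + 1))) (hb : ¬ BChain F i) :
    y T (uAt i) = levelCost i + y T (uAt (i + 1)) ∧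
      y T (wAt i) = levelCost i + y T (uAt (i + 1)) := by
  have h4 := four_le_levelCost i
  obtain ⟨j, hj⟩ := not_forall.1 hb
  have hb₀ := le_y_bAt_zero_of_notMem hT.isTree i fun h => hj (hT.subset h)
  constructor
  · have := y_u_le_levelCost_add hT hF i
    rcases y_u hT.isTree i with h | h <;> linarith
  · have := y_w_le_levelCost_add hT hF i
    rcases y_w hT.isTree i with ⟨j', h⟩ | h
    · have := le_y_aAt_zero_of_le_y_bAt hT.isTree i hb₀ j'
      linarith
    · linarith

theorem y_u_eq_y_w {m : ℕ} (hm : m ≤ n)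
    (h : ∀ i : Fin n, m ≤ i → BChain F i → ∃ j, AChain F i j) : y T (uAt m) = y T (wAt m) := by
  induction hm using Nat.decreasingInduction with
  | self => rw [uAt_last, wAt_last]
  | of_succ m hm ih =>
    have hnext := ih fun i hi => h i (m.le_succ.trans hi)
    by_cases hb : BChain F ⟨m, hm⟩
    · obtain ⟨j, hj⟩ := h ⟨m, hm⟩ le_rfl hb
      obtain ⟨hu, hw⟩ := y_u_eq_and_y_w_eq_of_bChain hT hF hnext hb hj
      exact hu.trans hw.symm
    · obtain ⟨hu, hw⟩ := y_u_eq_and_y_w_eq_of_not_bChain hT hF hnext hb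
      exact hu.trans hw.symm

/-- While level `l` has a complete `b`-path but no complete `a`-path, `u_l` profits from it and
`w_l` does not. The difference survives on the lower levels, since each of them costs `w` at least
as much as `u`. -/
theorem levelCost_add_y_u_le_y_w {l : Fin n} (hl : y T (uAt (l + 1)) = y T (wAt (l + 1)))
    (hb : BChain F l) (ha : ∀ j, ¬ AChain F l j) {m : ℕ} (hm : m ≤ l) :
    levelCost m + y T (uAt m) ≤ y T (wAt m) := by
  induction hm using Nat.decreasingInduction with
  | self =>
    have h₁ := y_u_le_y_b hT hF l
    have h₂ := y_bAt_le_of_bChain hT hb (Nat.zero_le _)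
    rcases y_w hT.isTree l with ⟨j, h⟩ | h
    · obtain ⟨k, hk⟩ := not_forall.1 (ha j)
      have := le_y_aAt_zero_of_notMem hT.isTree l fun h => hk (hT.subset h)
      linarith [four_le_levelCost l]
    · linarith
  | of_succ m hm ih =>
    lift m to Fin n using hm.trans l.2
    rw [levelCost_succ] at ih
    have h4 := four_le_levelCost m
    have h₁ := y_u_le_levelCost_add hT hF m
    rcases y_w hT.isTree m with ⟨j, h⟩ | h
    · have hb₀ := le_y_bAt_of_le_y_wAt hT.isTree m (by linarith) (Nat.zero_le _)
      rw [surcharge_zero, add_zero] at hb₀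
      have := le_y_aAt_zero_of_le_y_bAt hT.isTree m hb₀ j
      linarith
    · linarith

theorem b1_notMem_of_lt_of_not_aChain {l : Fin n} (hl : y T (uAt (l + 1)) = y T (wAt (l + 1)))
    (hb : BChain F l) (ha : ∀ j, ¬ AChain F l j) {i : Fin n} (hi : i < l) (j : Fin (r * s)) :
    b1 i j ∉ T := by
  have hgap := levelCost_add_y_u_le_y_w hT hF hl hb ha (m := i + 1) hi
  rw [levelCost_succ] at hgap
  exact b1_notMem_of_le_y_wAt hT hF (by linarith [four_le_levelCost i]) j

end Optimal

end lbGraph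

section StrictAntiSubsets

variable {ι α : Type*} [LinearOrder ι] [Preorder α]

open Classical in
/-- The subsets of `N` on which `β` is strictly decreasing. -/
noncomputable def strictAntiSubsets (β : ι → α) (N : Finset ι) : Finset (Finset ι) :=
  N.powerset.filter fun S => StrictAntiOn β S

theorem mem_strictAntiSubsets {β : ι → α} {N S : Finset ι} :
    S ∈ strictAntiSubsets β N ↔ S ⊆ N ∧ StrictAntiOn β S := by
  simp [strictAntiSubsets]

theorem card_strictAntiSubsets_empty (β : ι → α) : (strictAntiSubsets β ∅).card = 1 := by
  rw [Finset.card_eq_one]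
  refine ⟨∅, Finset.ext fun S => ?_⟩
  simp +contextual [mem_strictAntiSubsets, StrictAntiOn]

/-- The recursion of the counter, according to whether the set contains the level `l` that is
completed last. -/
theorem card_strictAntiSubsets_le {β : ι → α} {N : Finset ι} {l : ι}
    (hmin : ∀ i ∈ N, β l ≤ β i) :
    (strictAntiSubsets β N).card ≤
      (strictAntiSubsets β (N.erase l)).card + (strictAntiSubsets β (N.filter (· < l))).card := by
  classical
  have hsub : strictAntiSubsets β N ⊆ strictAntiSubsets β (N.erase l) ∪
      (strictAntiSubsets β (N.filter (· < l))).image (insert l) := by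
    intro S hS
    obtain ⟨hSN, hβ⟩ := mem_strictAntiSubsets.1 hS
    rw [Finset.mem_union, Finset.mem_image]
    by_cases hl : l ∈ S
    · refine Or.inr ⟨S.erase l, mem_strictAntiSubsets.2 ⟨fun i hi => ?_, hβ.mono ?_⟩,
        Finset.insert_erase hl⟩
      · obtain ⟨hne, hi⟩ := Finset.mem_erase.1 hi
        refine Finset.mem_filter.2 ⟨hSN hi, hne.lt_of_le (le_of_not_gt fun hli => ?_)⟩
        exact (hβ hl hi hli).not_ge (hmin i (hSN hi))
      · exact Finset.coe_subset.2 (S.erase_subset l)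
    · exact Or.inl (mem_strictAntiSubsets.2 ⟨Finset.subset_erase.2 ⟨hSN, hl⟩, hβ⟩)
  calc (strictAntiSubsets β N).card ≤ _ := Finset.card_le_card hsub
    _ ≤ _ := Finset.card_union_le _ _
    _ ≤ _ := Nat.add_le_add_left Finset.card_image_le _

end StrictAntiSubsets

namespace lbGraph

open LBVertex LBEdge WeightedDigraph

variable {n r s t : ℕ} {σ : LBEdge n r s t → ℕ} {z h m c : ℕ}
  {F F' B B' T : Finset (LBEdge n r s t)} {e : LBEdge n r s t} {i l : Fin n}

/-- The index at which the `b`-path of level `i` is completed; the algorithm adds the edges of the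
path in the decreasing order of their indices. -/
noncomputable def completion (σ : LBEdge n r s t → ℕ) (i : Fin n) : ℕ :=
  sInf (Set.range fun j => σ (b1 i j))

theorem completion_le (σ : LBEdge n r s t → ℕ) (i : Fin n) (j : Fin (r * s)) :
    completion σ i ≤ σ (b1 i j) := Nat.sInf_le ⟨j, rfl⟩

theorem exists_completion_eq (hrs : 0 < r * s) (σ : LBEdge n r s t → ℕ) (i : Fin n) :
    ∃ j, σ (b1 i j) = completion σ i :=
  have : Nonempty (Fin (r * s)) := ⟨0, hrs⟩
  Nat.sInf_mem (Set.range_nonempty fun j => σ (b1 i j))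

/-- The permutations for which all levels work as bits of the counter: every group of parallel
edges has a copy with index at least `h`, every `a`-path has an edge with index less than `h`, every
`b`-path has an edge with index less than `z`, and on every level there is an `a`-path whose indices
are all at least `z`. -/
structure WellOrdered (σ : LBEdge n r s t → ℕ) (z h : ℕ) : Prop where
  available : ∀ g : LBBundle n r s, ∃ l, h ≤ σ (g.copy l)
  a_lt : ∀ i j, ∃ k, σ (a1 i j k) < h
  b_lt : ∀ i, ∃ j, σ (b1 i j) < z
  le_a : ∀ i, ∃ j, ∀ k, z ≤ σ (a1 i j k)

theorem WellOrdered.lt (hσ : WellOrdered σ z h) (i : Fin n) : z < h := by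
  obtain ⟨j, hj⟩ := hσ.le_a i
  obtain ⟨k, hk⟩ := hσ.a_lt i j
  exact (hj k).trans_lt hk

theorem WellOrdered.available_of_forall_mem (hσ : WellOrdered σ z h)
    (hF : ∀ e, h ≤ σ e → e ∈ F) : Available F :=
  fun g => (hσ.available g).imp fun _ => hF _

/-- Every level with a complete `b`-path has a complete `a`-path, so that in optimal trees the paths
from `u_i` and `w_i` have the same cost. -/
def Balanced (F : Finset (LBEdge n r s t)) : Prop := ∀ i, BChain F i → ∃ j, AChain F i j

theorem Balanced.y_u_eq_y_w (hA : Balanced F) (hT : (lbGraph n r s t).IsOptimal F T)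
    (hF : Available F) (i : Fin n) : y T (uAt (i + 1)) = y T (wAt (i + 1)) :=
  lbGraph.y_u_eq_y_w hT hF i.2 fun i _ => hA i

theorem Balanced.bChain (hA : Balanced F) (hT : (lbGraph n r s t).IsOptimal F T)
    (hF : Available F) (hi : BChain F i) : BChain T i :=
  bChain_of_y_u_eq_y_w hT hi (hA.y_u_eq_y_w hT hF i)

theorem Balanced.aChain (hA : Balanced F) (hT : (lbGraph n r s t).IsOptimal F T)
    (hF : Available F) (hi : BChain F i) {j : Fin r} (hj : AChain F i j) : AChain T i j :=
  aChain_of_y_u_eq_y_w hT hj hi (hA.y_u_eq_y_w hT hF i)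

/-- Level `i` has an `a`-path in `F` all of whose indices are at least `z`. -/
def HasLateAChain (σ : LBEdge n r s t → ℕ) (z : ℕ) (F : Finset (LBEdge n r s t)) (i : Fin n) :
    Prop := ∃ j, AChain F i j ∧ ∀ k, z ≤ σ (a1 i j k)

theorem HasLateAChain.mono (h : HasLateAChain σ z F i) (hF : F ⊆ F') : HasLateAChain σ z F' i :=
  h.imp fun _ hj => ⟨fun k => hF (hj.1 k), hj.2⟩

theorem balanced_of_hasLateAChain (h : ∀ i, BChain F i → HasLateAChain σ z F i) : Balanced F :=
  fun i hi => (h i hi).imp fun _ hj => hj.1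

theorem forall_mem_without (hF : ∀ f, h ≤ σ f → f ∈ F) (he : σ e < h) (f : LBEdge n r s t)
    (hf : h ≤ σ f) : f ∈ without F e :=
  mem_without.2 ⟨fun hfe => he.not_ge (hfe ▸ hf), hF f hf⟩

theorem bChain_without_iff (hb : ∀ j, b1 i j ≠ e) : BChain (without F e) i ↔ BChain F i :=
  forall_congr' fun j => by simp only [mem_without, ne_eq, hb j, not_false_eq_true, true_and]

theorem aChain_without_iff {j : Fin r} (ha : ∀ k, a1 i j k ≠ e) :
    AChain (without F e) i j ↔ AChain F i j :=
  forall_congr' fun k => by simp only [mem_without, ne_eq, ha k, not_false_eq_true, true_and]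

theorem mem_switch_of_mem {f : LBEdge n r s t} (hf : f ∈ B) (hne : f.src ≠ e.src) :
    f ∈ (lbGraph n r s t).switch B e :=
  mem_switch.2 (Or.inr ⟨hf, hne⟩)

theorem mem_of_mem_switch {f : LBEdge n r s t} (hf : f ∈ (lbGraph n r s t).switch B e)
    (hne : f ≠ e) : f ∈ B :=
  (mem_switch.1 hf).elim (fun h => absurd h hne) And.left

/-- The invariant of a call that counts with the levels below `m`: their bits are reset, while the
bits of the other levels are those of an optimal tree. -/
structure Ready (σ : LBEdge n r s t → ℕ) (z h : ℕ) (F B : Finset (LBEdge n r s t)) (m : ℕ) :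
    Prop where
  mem_of_le : ∀ e, h ≤ σ e → e ∈ F
  b1_notMem : ∀ i : Fin n, i < m → ∀ j, b1 i j ∉ B
  hasLateAChain : ∀ i, BChain F i → HasLateAChain σ z F i

/-- The invariant of a call that completes the bit of level `l` by adding `a`-paths: no edge of the
`a`-paths of this level is used yet. -/
structure Pending (σ : LBEdge n r s t → ℕ) (z h : ℕ) (F B : Finset (LBEdge n r s t)) (l : Fin n) :
    Prop where
  mem_of_le : ∀ e, h ≤ σ e → e ∈ F
  bChain_self : BChain F l
  hasLateAChain_self : HasLateAChain σ z F l
  a1_notMem : ∀ j k, a1 l j k ∉ B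
  chains : ∀ i, i ≠ l → BChain F i → BChain B i ∧ HasLateAChain σ z B i

theorem pending_switch_b1 (hσ : WellOrdered σ z h) {j : Fin (r * s)}
    (hF : ∀ e, h ≤ σ e → e ∈ F) (hlt : σ (b1 l j) < h) (hb : BChain F l)
    (ha : ∀ i, BChain F i → HasLateAChain σ z F i)
    (hT : (lbGraph n r s t).IsOptimal (without F (b1 l j)) T) :
    Pending σ z h F ((lbGraph n r s t).switch T (b1 l j)) l := by
  have hav := hσ.available_of_forall_mem (forall_mem_without hF hlt)
  have hbal : Balanced (without F (b1 l j)) := fun i hi =>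
    (ha i (hi.mono (without_subset F _))).imp fun j' hj' =>
      (aChain_without_iff fun _ => by simp).2 hj'.1
  refine ⟨hF, hb, ha l hb, fun j' k hk => ?_, fun i hi hbi => ?_⟩
  · have hl : ¬ BChain (without F (b1 l j)) l := fun h' => (mem_without.1 (h' j)).1 rfl
    exact a1_notMem_of_not_bChain hT hav hl j' k (mem_of_mem_switch hk (by simp))
  · have hbi' : BChain (without F (b1 l j)) i := (bChain_without_iff fun j' => by simp [hi]).2 hbi
    refine ⟨fun j' => mem_switch_of_mem (hbal.bChain hT hav hbi' j') (by simp [LBEdge.src, hi]), ?_⟩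
    obtain ⟨j', hj', hz⟩ := ha i hbi
    have hA : AChain (without F (b1 l j)) i j' := (aChain_without_iff fun k => by simp).2 hj'
    exact ⟨j', fun k => mem_switch_of_mem (hbal.aChain hT hav hbi' hA k) (by simp [LBEdge.src]), hz⟩

theorem Pending.hasLateAChain (hp : Pending σ z h F B l) (hBF : B ⊆ F) (i : Fin n)
    (hi : BChain F i) : HasLateAChain σ z F i := by
  by_cases hil : i = l
  · exact hil ▸ hp.hasLateAChain_self
  · exact (hp.chains i hil hi).2.mono hBF

theorem Pending.lt_of_isFirst (hp : Pending σ z h F B l) (hσ : WellOrdered σ z h)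
    (he : IsFirst σ F B e) : σ e < h := by
  obtain ⟨j, hj, -⟩ := hp.hasLateAChain_self
  obtain ⟨k, hk⟩ := hσ.a_lt l j
  exact (he.2.2 _ (hj k) (hp.a1_notMem j k)).trans_lt hk

theorem Pending.pending_without (hp : Pending σ z h F B l) (hσ : WellOrdered σ z h)
    (he : IsFirst σ F B e) (hb : ∀ j, b1 l j ≠ e)
    (ha : HasLateAChain σ z (without F e) l) : Pending σ z h (without F e) B l where
  mem_of_le := forall_mem_without hp.mem_of_le (hp.lt_of_isFirst hσ he)
  bChain_self := (bChain_without_iff hb).2 hp.bChain_self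
  hasLateAChain_self := ha
  a1_notMem := hp.a1_notMem
  chains i hi hbi := hp.chains i hi (hbi.mono (without_subset F e))

theorem Pending.bChain_without (hp : Pending σ z h F B l) (hBF : B ⊆ without F e)
    (hb : ∀ j, b1 l j ≠ e) (i : Fin n) (hi : BChain F i) :
    BChain (without F e) i := by
  by_cases hil : i = l
  · exact hil ▸ (bChain_without_iff hb).2 hp.bChain_self
  · exact (hp.chains i hil hi).1.mono hBF

/-- If the first edge belongs to the last late `a`-path, then all `a`-paths of level `l` that remain
are late as well, since their edges are not used. -/
theorem Pending.exists_eq_a1 (hp : Pending σ z h F B l) (he : IsFirst σ F B e)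
    (ha : ¬ HasLateAChain σ z (without F e) l) :
    (∃ j k, e = a1 l j k ∧ AChain F l j) ∧ ∀ j, ¬ AChain (without F e) l j := by
  obtain ⟨j₀, hj₀, hz⟩ := hp.hasLateAChain_self
  obtain ⟨k₀, rfl⟩ : ∃ k, e = a1 l j₀ k := by
    by_contra! hne
    exact ha ⟨j₀, (aChain_without_iff fun k => (hne k).symm).2 hj₀, hz⟩
  refine ⟨⟨j₀, k₀, rfl, hj₀⟩, fun j hj => ha ⟨j, hj, fun k => ?_⟩⟩
  exact (hz k₀).trans (he.2.2 _ (without_subset F _ (hj k)) (hp.a1_notMem j k))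

theorem Pending.ready_switch_a1 (hp : Pending σ z h F B l) (hσ : WellOrdered σ z h) {j : Fin r}
    {k : Fin s} (hlt : σ (a1 l j k) < h) (hBF : B ⊆ without F (a1 l j k))
    (hT : (lbGraph n r s t).IsOptimal (without F (a1 l j k)) T)
    (ha : ∀ j', ¬ AChain (without F (a1 l j k)) l j') :
    Ready σ z h F ((lbGraph n r s t).switch T (a1 l j k)) l where
  mem_of_le := hp.mem_of_le
  b1_notMem i hi j' hj' := by
    have hav := hσ.available_of_forall_mem (forall_mem_without hp.mem_of_le hlt)
    have hl : y T (uAt (l + 1)) = y T (wAt (l + 1)) := by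
      refine y_u_eq_y_w hT hav l.2 fun i hi hbi => ?_
      have hil : i ≠ l := fun h => by omega
      obtain ⟨-, j', hj', -⟩ := hp.chains i hil (hbi.mono (without_subset F _))
      exact ⟨j', fun k => hBF (hj' k)⟩
    have hb : BChain (without F (a1 l j k)) l := (bChain_without_iff (by simp)).2 hp.bChain_self
    exact b1_notMem_of_lt_of_not_aChain hT hav hl hb ha hi j' (mem_of_mem_switch hj' (by simp))
  hasLateAChain := hp.hasLateAChain (hBF.trans (without_subset F _))

theorem Pending.isImprovingSwitch (hp : Pending σ z h F B l) (hσ : WellOrdered σ z h)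
    (hBF : B ⊆ F) (hT : (lbGraph n r s t).IsOptimal (without F e) T)
    (he : (∃ j, e = b1 l j) ∨ ∃ j k, e = a1 l j k ∧ AChain F l j) :
    (lbGraph n r s t).IsImprovingSwitch T e := by
  by_contra hn
  have hT' := hT.of_without hn
  have hav := hσ.available_of_forall_mem hp.mem_of_le
  have hbal := balanced_of_hasLateAChain (hp.hasLateAChain hBF)
  suffices e ∈ T from (mem_without.1 (hT.subset this)).1 rfl
  rcases he with ⟨j, rfl⟩ | ⟨j, k, rfl, hj⟩
  · exact hbal.bChain hT' hav hp.bChain_self j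
  · exact hbal.aChain hT' hav hp.bChain_self hj k

theorem exists_ready_of_pending (hσ : WellOrdered σ z h)
    (hRF : (lbGraph n r s t).RandomFacet1P σ F B B' c) (hB : (lbGraph n r s t).IsTree B)
    (hp : Pending σ z h F B l) :
    ∃ F₃ B₃ B₄ c₃, (lbGraph n r s t).RandomFacet1P σ F₃ B₃ B₄ c₃ ∧ c₃ ≤ c ∧
      (lbGraph n r s t).IsTree B₃ ∧ Ready σ z h F₃ B₃ l ∧ ∀ i, BChain F i → BChain F₃ i := by
  induction hRF with
  | done B =>
    obtain ⟨j, hj, -⟩ := hp.hasLateAChain_self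
    obtain ⟨k, -⟩ := hσ.a_lt l j
    exact absurd (hj k) (hp.a1_notMem j k)
  | stay F B B' e c he h₁ hn ih =>
    have hopt := h₁.isOptimal lbGraph_isRanking hB
    have himp := hp.isImprovingSwitch hσ (h₁.subset.trans (without_subset F e)) hopt
    have hb : ∀ j, b1 l j ≠ e := fun j hj => hn (himp (Or.inl ⟨j, hj.symm⟩))
    have ha : HasLateAChain σ z (without F e) l := by
      by_contra ha
      exact hn (himp (Or.inr (hp.exists_eq_a1 he ha).1))
    obtain ⟨F₃, B₃, B₄, c₃, hRF, hc, hB₃, hR, hb₃⟩ := ih hB (hp.pending_without hσ he hb ha)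
    exact ⟨F₃, B₃, B₄, c₃, hRF, hc, hB₃, hR, fun i hi =>
      hb₃ i (hp.bChain_without h₁.subset hb i hi)⟩
  | step F B B' B'' e c₁ c₂ he h₁ hi h₂ ih₁ ih₂ =>
    have hopt := h₁.isOptimal lbGraph_isRanking hB
    have hlt := hp.lt_of_isFirst hσ he
    have hB₂ := hopt.isTree.switch lbGraph_isRanking e
    by_cases hb : ∃ j, b1 l j = e
    · obtain ⟨j, rfl⟩ := hb
      obtain ⟨F₃, B₃, B₄, c₃, hRF, hc, h⟩ := ih₂ hB₂ (pending_switch_b1 hσ hp.mem_of_le hlt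
        hp.bChain_self (hp.hasLateAChain (h₁.subset.trans (without_subset F _))) hopt)
      exact ⟨F₃, B₃, B₄, c₃, hRF, by omega, h⟩
    push Not at hb
    by_cases ha : HasLateAChain σ z (without F e) l
    · obtain ⟨F₃, B₃, B₄, c₃, hRF, hc, hB₃, hR, hb₃⟩ := ih₁ hB (hp.pending_without hσ he hb ha)
      exact ⟨F₃, B₃, B₄, c₃, hRF, by omega, hB₃, hR, fun i hi =>
        hb₃ i (hp.bChain_without h₁.subset hb i hi)⟩
    · obtain ⟨⟨j, k, rfl, -⟩, hal⟩ := hp.exists_eq_a1 he ha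
      exact ⟨F, _, B'', c₂, h₂, by omega, hB₂, hp.ready_switch_a1 hσ hlt h₁.subset hopt hal,
        fun i hi => hi⟩

theorem Ready.lt_of_isFirst (hready : Ready σ z h F B m) (hσ : WellOrdered σ z h)
    (he : IsFirst σ F B e) (hl : l < m) (hb : BChain F l) : σ e < z := by
  obtain ⟨j, hj⟩ := hσ.b_lt l
  exact (he.2.2 _ (hb j) (hready.b1_notMem l hl j)).trans_lt hj

theorem Ready.ready_without (hready : Ready σ z h F B m) (hzh : z ≤ h) (he : σ e < z) :
    Ready σ z h (without F e) B m where
  mem_of_le := forall_mem_without hready.mem_of_le (he.trans_le hzh)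
  b1_notMem := hready.b1_notMem
  hasLateAChain i hi := by
    obtain ⟨j, hj, hz⟩ := hready.hasLateAChain i (hi.mono (without_subset F e))
    have ha : ∀ k, a1 i j k ≠ e := fun k hk => (hz k).not_gt (hk ▸ he)
    exact ⟨j, (aChain_without_iff ha).2 hj, hz⟩

theorem Ready.completion_le_completion (hready : Ready σ z h F B m) {j : Fin (r * s)}
    (he : IsFirst σ F B (b1 l j)) (hi : i < m) (hb : BChain F i) :
    completion σ l ≤ completion σ i := by
  obtain ⟨j', hj'⟩ := exists_completion_eq j.pos σ i
  rw [← hj']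
  exact (completion_le σ l j).trans (he.2.2 _ (hb j') (hready.b1_notMem i hi j'))

theorem Ready.isImprovingSwitch_b1 (hready : Ready σ z h F B m) (hσ : WellOrdered σ z h)
    {j : Fin (r * s)} (hT : (lbGraph n r s t).IsOptimal (without F (b1 l j)) T)
    (hb : BChain F l) : (lbGraph n r s t).IsImprovingSwitch T (b1 l j) := by
  by_contra hn
  have := (balanced_of_hasLateAChain hready.hasLateAChain).bChain (hT.of_without hn)
    (hσ.available_of_forall_mem hready.mem_of_le) hb j
  exact (mem_without.1 (hT.subset this)).1 rfl

theorem Ready.exists_ready_of_switch_b1 (hready : Ready σ z h F B m) (hσ : WellOrdered σ z h)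
    {j : Fin (r * s)} (hlt : σ (b1 l j) < h) (hb : BChain F l)
    (hT : (lbGraph n r s t).IsOptimal (without F (b1 l j)) T)
    (hRF : (lbGraph n r s t).RandomFacet1P σ F ((lbGraph n r s t).switch T (b1 l j)) B' c) :
    ∃ F₃ B₃ B₄ c₃, (lbGraph n r s t).RandomFacet1P σ F₃ B₃ B₄ c₃ ∧ c₃ ≤ c ∧
      (lbGraph n r s t).IsTree B₃ ∧ Ready σ z h F₃ B₃ l ∧ ∀ i, BChain F i → BChain F₃ i :=
  exists_ready_of_pending hσ hRF (hT.isTree.switch lbGraph_isRanking _)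
    (pending_switch_b1 hσ hready.mem_of_le hlt hb hready.hasLateAChain hT)

theorem card_strictAntiSubsets_le_of_ready (hσ : WellOrdered σ z h)
    (hRF : (lbGraph n r s t).RandomFacet1P σ F B B' c) (hB : (lbGraph n r s t).IsTree B)
    (hready : Ready σ z h F B m) (N : Finset (Fin n)) (hN : ∀ i ∈ N, i < m ∧ BChain F i) :
    (strictAntiSubsets (completion σ) N).card ≤ c + 1 := by
  induction m using Nat.strong_induction_on generalizing F B B' c N with
  | _ m ihm =>
  induction hRF generalizing N with
  | done B =>
    have hN₀ : N = ∅ := Finset.eq_empty_of_forall_notMem fun i hi => by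
      obtain ⟨j, -⟩ := hσ.b_lt i
      exact hready.b1_notMem i (hN i hi).1 j ((hN i hi).2 j)
    rw [hN₀, card_strictAntiSubsets_empty]
  | stay F B B' e c he h₁ hn ih =>
    rcases N.eq_empty_or_nonempty with rfl | ⟨l₀, hl₀⟩
    · simp [card_strictAntiSubsets_empty]
    have hlt := hready.lt_of_isFirst hσ he (hN l₀ hl₀).1 (hN l₀ hl₀).2
    refine ih hB (hready.ready_without (hσ.lt l₀).le hlt) N fun i hi => ⟨(hN i hi).1, ?_⟩
    refine (bChain_without_iff ?_).2 (hN i hi).2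
    rintro j rfl
    exact hn (hready.isImprovingSwitch_b1 hσ (h₁.isOptimal lbGraph_isRanking hB) (hN i hi).2)
  | step F B B' B'' e c₁ c₂ he h₁ hi h₂ ih₁ ih₂ =>
    rcases N.eq_empty_or_nonempty with rfl | ⟨l₀, hl₀⟩
    · simp [card_strictAntiSubsets_empty]
    have hlt := hready.lt_of_isFirst hσ he (hN l₀ hl₀).1 (hN l₀ hl₀).2
    have ih₁ := ih₁ hB (hready.ready_without (hσ.lt l₀).le hlt)
    by_cases hex : ∃ l ∈ N, ∃ j, b1 l j = e
    · obtain ⟨l, hl, j, rfl⟩ := hex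
      have hbit_unset := ih₁ (N.erase l) fun i hi =>
        have ⟨hil, hi⟩ := Finset.mem_erase.1 hi
        ⟨(hN i hi).1, (bChain_without_iff fun j' => by simp [hil]).2 (hN i hi).2⟩
      obtain ⟨F₃, B₃, B₄, c₃, hRF, hc₃, hB₃, hR, hb⟩ :=
        hready.exists_ready_of_switch_b1 hσ (hlt.trans (hσ.lt l)) (hN l hl).2
          (h₁.isOptimal lbGraph_isRanking hB) h₂
      have hbit_set := ihm l (hN l hl).1 hRF hB₃ hR (N.filter (· < l)) fun i hi =>
        have ⟨hi, hil⟩ := Finset.mem_filter.1 hi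
        ⟨hil, hb i (hN i hi).2⟩
      have := card_strictAntiSubsets_le fun i hi =>
        hready.completion_le_completion he (hN i hi).1 (hN i hi).2
      omega
    · push Not at hex
      have := ih₁ N fun i hi => ⟨(hN i hi).1, (bChain_without_iff (hex i hi)).2 (hN i hi).2⟩
      omega

theorem card_strictAntiSubsets_le_numSwitches (hσ : WellOrdered σ z h)
    (hB : (lbGraph n r s t).IsTree B) (hB₀ : ∀ e ∈ B, e.IsZeroEdge) :
    (strictAntiSubsets (completion σ) Finset.univ).card ≤
      (lbGraph n r s t).numSwitches σ Finset.univ B + 1 := by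
  obtain ⟨B', hRF⟩ := exists_randomFacet1P_numSwitches
    (lbGraph_isRanking.exists_randomFacet1P σ (Finset.subset_univ B) hB)
  have hready : Ready σ z h Finset.univ B n :=
    { mem_of_le := fun e _ => Finset.mem_univ e
      b1_notMem := fun i _ j hj => hB₀ _ hj
      hasLateAChain := fun i _ => (hσ.le_a i).imp fun _ hj => ⟨fun _ => Finset.mem_univ _, hj⟩ }
  exact card_strictAntiSubsets_le_of_ready hσ hRF hB hready _ fun i _ =>
    ⟨i.2, fun j => Finset.mem_univ _⟩

end lbGraph

section RandomBijection

open Finset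

open scoped BigOperators

variable {Ω ι : Type*} [Fintype Ω]

theorem dens_filter_exists_le [Fintype ι] (P : ι → Ω → Prop) [∀ i, DecidablePred (P i)]
    [DecidablePred fun ω => ∃ i, P i ω] {x : ℚ≥0} (h : ∀ i, dens {ω | P i ω} ≤ x) :
    dens {ω | ∃ i, P i ω} ≤ Fintype.card ι * x := by
  classical
  calc dens {ω | ∃ i, P i ω} = dens (univ.biUnion fun i => ({ω | P i ω} : Finset Ω)) := by
        congr 1
        ext ω
        simp
    _ ≤ ∑ i, dens {ω | P i ω} := dens_biUnion_le
    _ ≤ ∑ _i : ι, x := sum_le_sum fun i _ => h i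
    _ = Fintype.card ι * x := by simp

theorem dens_filter_comp_equiv (φ : Ω ≃ Ω) (P : Ω → Prop) [DecidablePred P] :
    dens {ω | P (φ ω)} = dens {ω | P ω} := by
  simp only [dens_eq_card_div_card, ← Fintype.card_subtype]
  rw [Fintype.card_congr (φ.subtypeEquiv fun _ => Iff.rfl)]

theorem sum_dens_filter_eq_expect (T : Finset ι) (Q : ι → Ω → Prop)
    [∀ ω, DecidablePred fun i => Q i ω] :
    ∑ i ∈ T, (dens {ω | Q i ω} : ℝ) = 𝔼 ω, (#{i ∈ T | Q i ω} : ℝ) := by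
  have h := sum_card_bipartiteAbove_eq_sum_card_bipartiteBelow (s := T) (t := univ) Q
  simp only [bipartiteAbove, bipartiteBelow] at h
  rw [Fintype.expect_eq_sum_div_card]
  simp only [nnratCast_dens]
  rw [← sum_div]
  exact_mod_cast congrArg (fun m : ℕ => (m : ℝ) / Fintype.card Ω) h

variable {E α : Type*} [Fintype E] [DecidableEq E] [Fintype α] [DecidableEq α]

theorem card_equiv_insert_le (S : Finset α) {A : Finset E} {e : E} (he : e ∉ A) (e' : E) :
    #{σ : E ≃ α | ∀ f ∈ insert e A, σ f ∈ S} ≤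
      #{σ ∈ ({σ | ∀ f ∈ A, σ f ∈ S} : Finset (E ≃ α)) | σ e' ∈ S} := by
  simp only [filter_filter, forall_mem_insert]
  by_cases he' : e' ∈ A
  · exact card_le_card fun σ hσ => by
      simp only [mem_filter_univ] at hσ ⊢
      exact ⟨hσ.2, hσ.2 e' he'⟩
  refine card_le_card_of_injOn (fun σ => (Equiv.swap e e').trans σ) (fun σ hσ => ?_)
    fun σ _ τ _ h => Equiv.ext fun f => ?_
  · simp only [coe_filter, mem_univ, true_and, Set.mem_ofPred_eq, Equiv.trans_apply,
      Equiv.swap_apply_right] at hσ ⊢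
    refine ⟨fun f hf => ?_, hσ.1⟩
    rw [Equiv.swap_apply_of_ne_of_ne (ne_of_mem_of_not_mem hf he) (ne_of_mem_of_not_mem hf he')]
    exact hσ.2 f hf
  · simpa using Equiv.congr_fun h (Equiv.swap e e' f)

theorem dens_equiv_insert_le (S : Finset α) {A : Finset E} {e : E} (he : e ∉ A) :
    dens {σ : E ≃ α | ∀ f ∈ insert e A, σ f ∈ S} ≤
      dens {σ : E ≃ α | ∀ f ∈ A, σ f ∈ S} * (#S / Fintype.card α) := by
  have hcount (σ : E ≃ α) : #{e' | σ e' ∈ S} = #S :=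
    card_bij (fun e' _ => σ e') (by simp) (fun _ _ _ _ h => σ.injective h)
      fun x hx => ⟨σ.symm x, by simpa using hx, σ.apply_symm_apply x⟩
  have hdouble : Fintype.card E * #{σ : E ≃ α | ∀ f ∈ insert e A, σ f ∈ S} ≤
      #{σ : E ≃ α | ∀ f ∈ A, σ f ∈ S} * #S := by
    calc _ = ∑ _e' : E, #{σ : E ≃ α | ∀ f ∈ insert e A, σ f ∈ S} := by simp
      _ ≤ ∑ e' : E, #{σ ∈ ({σ | ∀ f ∈ A, σ f ∈ S} : Finset (E ≃ α)) | σ e' ∈ S} :=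
        sum_le_sum fun e' _ => card_equiv_insert_le S he e'
      _ = ∑ σ : E ≃ α with ∀ f ∈ A, σ f ∈ S, #{e' | σ e' ∈ S} :=
        sum_card_bipartiteAbove_eq_sum_card_bipartiteBelow _
      _ = _ := by simp only [hcount, sum_const, smul_eq_mul]
  cases isEmpty_or_nonempty (E ≃ α) with
  | inl _ => simp
  | inr hσ =>
  rw [← Fintype.card_congr hσ.some]
  have hE : (0 : ℚ≥0) < Fintype.card E := by exact_mod_cast Fintype.card_pos_iff.2 ⟨e⟩
  rw [dens_eq_card_div_card, dens_eq_card_div_card, div_mul_eq_mul_div]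
  gcongr
  rw [← mul_div_assoc, le_div_iff₀' hE]
  exact_mod_cast hdouble

theorem dens_equiv_forall_mem_le (S : Finset α) (A : Finset E) :
    dens {σ : E ≃ α | ∀ f ∈ A, σ f ∈ S} ≤ (#S / Fintype.card α : ℚ≥0) ^ #A := by
  induction A using Finset.induction_on with
  | empty => simp
  | insert e A he ih =>
    rw [card_insert_of_notMem he, pow_succ]
    exact (dens_equiv_insert_le S he).trans (mul_le_mul_left ih _)

variable {M : ℕ} [Fintype ι] {g : ι → E}

theorem dens_equiv_forall_comp_mem_le (hg : Function.Injective g) (S : Finset α) :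
    dens {σ : E ≃ α | ∀ i, σ (g i) ∈ S} ≤ (#S / Fintype.card α : ℚ≥0) ^ Fintype.card ι := by
  have h := dens_equiv_forall_mem_le S (univ.map ⟨g, hg⟩)
  rw [card_map, card_univ] at h
  simpa using h

theorem dens_equiv_forall_lt_le (hg : Function.Injective g) (h : ℕ) :
    dens {σ : E ≃ Fin M | ∀ i, (σ (g i) : ℕ) < h} ≤
      (h / M : ℚ≥0) ^ Fintype.card ι := by
  have hS : #{x : Fin M | (x : ℕ) < h} ≤ h := by
    rw [Fin.card_filter_val_lt]
    exact min_le_right _ _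
  refine le_trans ?_ ((dens_equiv_forall_comp_mem_le hg {x : Fin M | (x : ℕ) < h}).trans ?_)
  · simp
  · rw [Fintype.card_fin]
    gcongr

theorem dens_equiv_forall_le_le (hg : Function.Injective g) (h : ℕ) :
    dens {σ : E ≃ Fin M | ∀ i, h ≤ (σ (g i) : ℕ)} ≤
      ((M - h : ℕ) / M : ℚ≥0) ^ Fintype.card ι := by
  have hS : #{x : Fin M | h ≤ (x : ℕ)} ≤ M - h := by
    have := card_filter_add_card_filter_not (s := (univ : Finset (Fin M))) fun x => (x : ℕ) < h
    simp only [Fin.card_filter_val_lt, not_lt, card_univ, Fintype.card_fin] at this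
    omega
  refine le_trans ?_ ((dens_equiv_forall_comp_mem_le hg {x : Fin M | h ≤ (x : ℕ)}).trans ?_)
  · simp
  · rw [Fintype.card_fin]
    gcongr

variable {κ : Type*} [Fintype κ] {g : κ → ι → E}

theorem dens_equiv_exists_forall_lt_le (hg : ∀ x, Function.Injective (g x)) (h : ℕ)
    [DecidablePred fun σ : E ≃ Fin M => ∃ x, ∀ i, (σ (g x i) : ℕ) < h] :
    dens {σ : E ≃ Fin M | ∃ x, ∀ i, (σ (g x i) : ℕ) < h} ≤
      Fintype.card κ * (h / M : ℚ≥0) ^ Fintype.card ι :=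
  dens_filter_exists_le _ fun x => dens_equiv_forall_lt_le (hg x) h

theorem dens_equiv_exists_forall_le_le (hg : ∀ x, Function.Injective (g x)) (h : ℕ)
    [DecidablePred fun σ : E ≃ Fin M => ∃ x, ∀ i, h ≤ (σ (g x i) : ℕ)] :
    dens {σ : E ≃ Fin M | ∃ x, ∀ i, h ≤ (σ (g x i) : ℕ)} ≤
      Fintype.card κ * ((M - h : ℕ) / M : ℚ≥0) ^ Fintype.card ι :=
  dens_filter_exists_le _ fun x => dens_equiv_forall_le_le (hg x) h

end RandomBijection

namespace LBEdge

variable {n r s t : ℕ}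

/-- The action on edges of a map of the levels. -/
def mapLevel (f : Fin n → Fin n) : LBEdge n r s t → LBEdge n r s t
  | a1 i j k => a1 (f i) j k
  | a0 i j k l => a0 (f i) j k l
  | b1 i j => b1 (f i) j
  | b0 i j l => b0 (f i) j l
  | u1 i l => u1 (f i) l
  | u0 i l => u0 (f i) l
  | w1 i j l => w1 (f i) j l
  | w0 i l => w0 (f i) l

/-- The permutation of the edges induced by a permutation of the levels. -/
def permLevel (π : Equiv.Perm (Fin n)) : Equiv.Perm (LBEdge n r s t) where
  toFun := mapLevel π
  invFun := mapLevel π.symm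
  left_inv e := by cases e <;> simp [mapLevel]
  right_inv e := by cases e <;> simp [mapLevel]

end LBEdge

theorem exists_perm_strictAntiOn {ι α : Type*} [LinearOrder ι] [LinearOrder α] (S : Finset ι)
    {β : ι → α} (hβ : Function.Injective β) :
    ∃ τ : Equiv.Perm (Fin S.card),
      StrictAntiOn (β ∘ τ.extendDomain (S.orderIsoOfFin rfl).toEquiv) S := by
  let o := S.orderIsoOfFin rfl
  let f : Fin S.card → αᵒᵈ := fun a => OrderDual.toDual (β (o a))
  refine ⟨Tuple.sort f, fun i hi j hj hij => ?_⟩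
  obtain ⟨a, ha⟩ := o.surjective ⟨i, hi⟩
  obtain ⟨b, hb⟩ := o.surjective ⟨j, hj⟩
  obtain rfl : (o.toEquiv a : ι) = i := congrArg Subtype.val ha
  obtain rfl : (o.toEquiv b : ι) = j := congrArg Subtype.val hb
  have hab : a < b := o.lt_iff_lt.1 hij
  refine lt_of_le_of_ne ?_ fun h => hij.ne' (Equiv.injective _ (hβ h))
  simp only [Function.comp_apply, o, Equiv.Perm.extendDomain_apply_image]
  exact Tuple.monotone_sort f hab.le

namespace lbGraph

open LBEdge Finset

open scoped BigOperators Nat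

variable {n r s t M : ℕ} {σ : LBEdge n r s t → ℕ} {z h : ℕ}

theorem not_wellOrdered (hσ : ¬ WellOrdered σ z h) :
    (((∃ g : LBBundle n r s, ∀ l, σ (g.copy l) < h) ∨
      (∃ x : Fin n × Fin r, ∀ k, h ≤ σ (a1 x.1 x.2 k))) ∨
      (∃ i, ∀ j, z ≤ σ (b1 i j))) ∨
      (∃ x : Fin n × (Fin r → Fin s), ∀ j, σ (a1 x.1 j (x.2 j)) < z) := by
  contrapose! hσ
  obtain ⟨⟨⟨hg, ha⟩, hb⟩, hz⟩ := hσ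
  refine ⟨hg, fun i j => ha (i, j), hb, fun i => ?_⟩
  by_contra! hi
  choose κ hκ using hi
  obtain ⟨j, hj⟩ := hz (i, κ)
  exact (hκ j).not_ge hj

theorem injective_a1 (i : Fin n) (j : Fin r) :
    Function.Injective (a1 i j : Fin s → LBEdge n r s t) := fun _ _ h => by simpa using h

theorem injective_b1 (i : Fin n) : Function.Injective (b1 i : _ → LBEdge n r s t) :=
  fun _ _ h => by simpa using h

theorem injective_a1_path (i : Fin n) (κ : Fin r → Fin s) :
    Function.Injective fun j => (a1 i j (κ j) : LBEdge n r s t) :=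
  fun _ _ h => by simp only [a1.injEq] at h; exact h.2.1

open Classical in
theorem dens_not_wellOrdered_le (z h : ℕ) :
    dens {σ : LBEdge n r s t ≃ Fin M | ¬ WellOrdered (fun e => σ e) z h} ≤
      Fintype.card (LBBundle n r s) * (h / M : ℚ≥0) ^ t + n * r * ((M - h : ℕ) / M : ℚ≥0) ^ s +
        n * ((M - z : ℕ) / M : ℚ≥0) ^ (r * s) + n * s ^ r * (z / M : ℚ≥0) ^ r := by
  let noCopy : Finset (LBEdge n r s t ≃ Fin M) :=
    {σ | ∃ g : LBBundle n r s, ∀ l, (σ (g.copy l) : ℕ) < h}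
  let noA : Finset (LBEdge n r s t ≃ Fin M) :=
    {σ | ∃ x : Fin n × Fin r, ∀ k, h ≤ (σ (a1 x.1 x.2 k) : ℕ)}
  let noB : Finset (LBEdge n r s t ≃ Fin M) := {σ | ∃ i, ∀ j, z ≤ (σ (b1 i j) : ℕ)}
  let earlyA : Finset (LBEdge n r s t ≃ Fin M) :=
    {σ | ∃ x : Fin n × (Fin r → Fin s), ∀ j, (σ (a1 x.1 j (x.2 j)) : ℕ) < z}
  calc dens {σ : LBEdge n r s t ≃ Fin M | ¬ WellOrdered (fun e => σ e) z h}
      ≤ dens (noCopy ∪ noA ∪ noB ∪ earlyA) := by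
        refine dens_le_dens fun σ hσ => ?_
        simpa only [noCopy, noA, noB, earlyA, mem_union, mem_filter_univ] using
          not_wellOrdered (mem_filter.1 hσ).2
    _ ≤ dens noCopy + dens noA + dens noB + dens earlyA := by
        exact (dens_union_le _ _).trans (add_le_add ((dens_union_le _ _).trans
          (add_le_add (dens_union_le _ _) le_rfl)) le_rfl)
    _ ≤ _ := by
        gcongr ?_ + ?_ + ?_ + ?_
        · exact (dens_equiv_exists_forall_lt_le LBBundle.copy_injective h).trans_eq (by simp)
        · exact (dens_equiv_exists_forall_le_le
            (g := fun (x : Fin n × Fin r) (k : Fin s) => (a1 x.1 x.2 k : LBEdge n r s t))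
            (fun x => injective_a1 x.1 x.2) h).trans_eq (by simp)
        · exact (dens_equiv_exists_forall_le_le (g := b1) injective_b1 z).trans_eq (by simp)
        · exact (dens_equiv_exists_forall_lt_le
            (g := fun (x : Fin n × (Fin r → Fin s)) j => (a1 x.1 j (x.2 j) : LBEdge n r s t))
            (fun x => injective_a1_path x.1 x.2) z).trans_eq (by simp)

theorem WellOrdered.comp_permLevel (hσ : WellOrdered σ z h) (π : Equiv.Perm (Fin n)) :
    WellOrdered (fun e => σ (permLevel π e)) z h where
  available
    | .a0 i j k => hσ.available (.a0 (π i) j k)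
    | .b0 i j => hσ.available (.b0 (π i) j)
    | .u1 i => hσ.available (.u1 (π i))
    | .u0 i => hσ.available (.u0 (π i))
    | .w1 i j => hσ.available (.w1 (π i) j)
    | .w0 i => hσ.available (.w0 (π i))
  a_lt i := hσ.a_lt (π i)
  b_lt i := hσ.b_lt (π i)
  le_a i := hσ.le_a (π i)

theorem completion_injective (hrs : 0 < r * s) (hσ : Function.Injective σ) :
    Function.Injective (completion σ) := by
  intro i i' h
  obtain ⟨j, hj⟩ := exists_completion_eq hrs σ i
  obtain ⟨j', hj'⟩ := exists_completion_eq hrs σ i'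
  have hb := hσ ((hj.trans h).trans hj'.symm)
  simp only [b1.injEq] at hb
  exact hb.1

open Classical in
/-- Permuting the levels of `S` preserves the distribution of `σ`, and one of the `|S|!`
permutations sorts the completion indices. -/
theorem dens_wellOrdered_le (hrs : 0 < r * s) (z h : ℕ) (S : Finset (Fin n)) :
    dens {σ : LBEdge n r s t ≃ Fin M | WellOrdered (fun e => σ e) z h} ≤
      (#S)! * dens {σ : LBEdge n r s t ≃ Fin M | WellOrdered (fun e => σ e) z h ∧
        S ∈ strictAntiSubsets (completion fun e => σ e) univ} := by
  let Q (σ : LBEdge n r s t ≃ Fin M) : Prop := WellOrdered (fun e => σ e) z h ∧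
    S ∈ strictAntiSubsets (completion fun e => σ e) univ
  let relabel (τ : Equiv.Perm (Fin #S)) : (LBEdge n r s t ≃ Fin M) ≃ (LBEdge n r s t ≃ Fin M) :=
    (permLevel (τ.extendDomain (S.orderIsoOfFin rfl).toEquiv)).symm.equivCongr (Equiv.refl _)
  calc dens {σ : LBEdge n r s t ≃ Fin M | WellOrdered (fun e => σ e) z h}
      ≤ dens {σ | ∃ τ, Q (relabel τ σ)} := by
        refine dens_le_dens (monotone_filter_right _ fun σ _ hσ => ?_)
        obtain ⟨τ, hτ⟩ := exists_perm_strictAntiOn S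
          (completion_injective hrs (Fin.val_injective.comp σ.injective))
        exact ⟨τ, hσ.comp_permLevel _, mem_strictAntiSubsets.2 ⟨subset_univ S, hτ⟩⟩
    _ ≤ Fintype.card (Equiv.Perm (Fin #S)) * dens {σ | Q σ} :=
        dens_filter_exists_le _ fun τ => (dens_filter_comp_equiv (relabel τ) Q).le
    _ = (#S)! * dens {σ | Q σ} := by rw [Fintype.card_perm, Fintype.card_fin]

open Classical in
theorem card_filter_powersetCard_le_numSwitches {k : ℕ} (hk : k ≠ 0) {σ : LBEdge n r s t → ℕ}
    {B : Finset (LBEdge n r s t)} (hB : (lbGraph n r s t).IsTree B)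
    (hB₀ : ∀ e ∈ B, e.IsZeroEdge) :
    #{S ∈ powersetCard k univ | WellOrdered σ z h ∧ S ∈ strictAntiSubsets (completion σ) univ} ≤
      (lbGraph n r s t).numSwitches σ univ B := by
  by_cases hσ : WellOrdered σ z h
  · have hcount := card_strictAntiSubsets_le_numSwitches hσ hB hB₀
    have hsub : ({S ∈ powersetCard k univ | WellOrdered σ z h ∧
        S ∈ strictAntiSubsets (completion σ) univ} : Finset (Finset (Fin n))) ⊆
          (strictAntiSubsets (completion σ) univ).erase ∅ := by
      intro S hS
      obtain ⟨hSk, -, hS⟩ := mem_filter.1 hS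
      refine mem_erase.2 ⟨?_, hS⟩
      rintro rfl
      exact hk (mem_powersetCard.1 hSk).2.symm
    have hempty : ∅ ∈ strictAntiSubsets (completion σ) univ := by
      simp [mem_strictAntiSubsets, StrictAntiOn]
    have hcard := card_le_card hsub
    rw [card_erase_of_mem hempty] at hcard
    omega
  · simp [hσ]

open Classical in
theorem choose_div_factorial_mul_le_expectedSwitches (hrs : 0 < r * s) {k : ℕ} (hk : k ≠ 0)
    (z h : ℕ) {B : Finset (LBEdge n r s t)} (hB : (lbGraph n r s t).IsTree B)
    (hB₀ : ∀ e ∈ B, e.IsZeroEdge) :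
    (n.choose k / k ! : ℝ) *
        (dens {σ : LBEdge n r s t ≃ Fin (lbNumEdges n r s t) | WellOrdered (fun e => σ e) z h} : ℝ)
      ≤ (lbGraph n r s t).expectedSwitches B := by
  set p := ((dens {σ : LBEdge n r s t ≃ Fin (lbNumEdges n r s t) |
    WellOrdered (fun e => σ e) z h} : ℚ≥0) : ℝ) with hp
  calc (n.choose k / k ! : ℝ) * p = ∑ _S ∈ powersetCard k (univ : Finset (Fin n)), p / k ! := by
        simp only [sum_const, card_powersetCard, card_univ, Fintype.card_fin, nsmul_eq_mul]
        ring
    _ ≤ ∑ S ∈ powersetCard k univ, (dens {σ : LBEdge n r s t ≃ Fin (lbNumEdges n r s t) |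
          WellOrdered (fun e => σ e) z h ∧
            S ∈ strictAntiSubsets (completion fun e => σ e) univ} : ℝ) := by
        refine sum_le_sum fun S hS => ?_
        rw [div_le_iff₀' (by positivity), hp]
        have hle := dens_wellOrdered_le (t := t) (M := lbNumEdges n r s t) hrs z h S
        rw [(mem_powersetCard.1 hS).2] at hle
        exact_mod_cast hle
    _ = 𝔼 σ : LBEdge n r s t ≃ Fin (lbNumEdges n r s t), (#{S ∈ powersetCard k univ |
          WellOrdered (fun e => σ e) z h ∧
            S ∈ strictAntiSubsets (completion fun e => σ e) univ} : ℝ) :=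
        sum_dens_filter_eq_expect _ _
    _ ≤ 𝔼 σ : LBEdge n r s t ≃ Fin (lbNumEdges n r s t),
          ((lbGraph n r s t).numSwitches (fun e => σ e) univ B : ℝ) :=
        expect_le_expect fun σ _ => by
          exact_mod_cast card_filter_powersetCard_le_numSwitches hk hB hB₀
    _ = (lbGraph n r s t).expectedSwitches B :=
        WeightedDigraph.expectedSwitches_eq_expect.symm

end lbGraph

theorem lbNumEdges_eq (n r s t : ℕ) :
    lbNumEdges n r s t = n * (2 * (r * s) + 2 * (r * s * t) + r * t + 3 * t) := by
  rw [lbNumEdges, ← Fintype.card_congr (LBEdge.proxyTypeEquiv n r s t)]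
  simp only [Fintype.card_sum, Fintype.card_sigma, Fintype.card_fin, Finset.sum_const,
    Finset.card_univ, smul_eq_mul]
  ring

theorem LBBundle.card_eq (n r s : ℕ) :
    Fintype.card (LBBundle n r s) = n * (2 * (r * s) + r + 3) := by
  rw [← Fintype.card_congr (LBBundle.proxyTypeEquiv n r s)]
  simp only [Fintype.card_sum, Fintype.card_sigma, Fintype.card_fin, Finset.sum_const,
    Finset.card_univ, smul_eq_mul]
  ring

section TailEstimates

variable {M m : ℕ}

theorem three_fifths_le_exp_neg_half : (3 / 5 : ℝ) ≤ Real.exp (-(1 / 2)) := by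
  have h : Real.exp (1 / 2) ≤ 5 / 3 := by
    have hsq : Real.exp (1 / 2) ^ 2 = Real.exp 1 := by
      rw [← Real.exp_nat_mul]
      norm_num
    nlinarith [Real.exp_one_lt_d9, Real.exp_pos (1 / 2)]
  rw [Real.exp_neg, le_inv_comm₀ (by norm_num) (Real.exp_pos _)]
  linarith

theorem half_div_le_exp_neg_half (M : ℕ) : ((M / 2 : ℕ) / M : ℝ) ≤ Real.exp (-(1 / 2)) := by
  have h : ((M / 2 : ℕ) : ℝ) ≤ M / 2 := Nat.cast_div_le
  exact (div_le_of_le_mul₀ M.cast_nonneg (by norm_num) (by linarith)).trans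
    three_fifths_le_exp_neg_half

theorem sub_half_div_le_exp_neg_half (hM : 5 ≤ M) :
    ((M - M / 2 : ℕ) / M : ℝ) ≤ Real.exp (-(1 / 2)) := by
  have h : (5 * (M - M / 2 : ℕ) : ℝ) ≤ 3 * M := by
    exact_mod_cast (by omega : 5 * (M - M / 2) ≤ 3 * M)
  exact (div_le_of_le_mul₀ M.cast_nonneg (by norm_num) (by linarith)).trans
    three_fifths_le_exp_neg_half

theorem div_two_mul_div_pow_le_exp (M m : ℕ) :
    (m : ℝ) ^ m * ((M / (2 * m) : ℕ) / M : ℝ) ^ m ≤ Real.exp (-(1 / 2)) ^ m := by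
  rw [← mul_pow, ← mul_div_assoc]
  refine pow_le_pow_left₀ (by positivity) (le_trans ?_ three_fifths_le_exp_neg_half) m
  have h : ((M / (2 * m) : ℕ) * (2 * m) : ℝ) ≤ M := by exact_mod_cast Nat.div_mul_le_self M (2 * m)
  exact div_le_of_le_mul₀ M.cast_nonneg (by norm_num) (by linarith)

theorem sub_div_two_mul_div_pow_le_exp (hm : m ≠ 0) (hM : 2 * m ^ 2 ≤ M) :
    ((M - M / (2 * m) : ℕ) / M : ℝ) ^ (m * m) ≤ 3 * Real.exp (-(1 / 2)) ^ m := by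
  have hM0 : (0 : ℝ) < M := by exact_mod_cast (by positivity : 0 < 2 * m ^ 2).trans_le hM
  have hz : (M : ℝ) ≤ ((M / (2 * m) : ℕ) + 1) * (2 * m) := by
    have hlt := (Nat.lt_div_mul_add (a := M) (by omega : 0 < 2 * m)).le
    exact_mod_cast hlt.trans_eq (by ring)
  have hexponent : (m : ℝ) / 2 - 1 ≤ m * m * ((M / (2 * m) : ℕ) / M) := by
    have hM' : 2 * (m : ℝ) ^ 2 ≤ M := by exact_mod_cast hM
    rw [← mul_div_assoc, le_div_iff₀ hM0]
    nlinarith [m.cast_nonneg (α := ℝ)]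
  calc ((M - M / (2 * m) : ℕ) / M : ℝ) ^ (m * m)
      = (1 - (M / (2 * m) : ℕ) / M) ^ (m * m) := by
        rw [Nat.cast_sub (Nat.div_le_self _ _), sub_div, div_self hM0.ne']
    _ ≤ Real.exp (-((M / (2 * m) : ℕ) / M)) ^ (m * m) := by
        refine pow_le_pow_left₀ ?_ (Real.one_sub_le_exp_neg _) _
        exact sub_nonneg.2 (div_le_one_of_le₀ (by exact_mod_cast Nat.div_le_self _ _) hM0.le)
    _ = Real.exp (-(m * m * ((M / (2 * m) : ℕ) / M))) := by
        rw [← Real.exp_nat_mul]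
        push_cast
        ring_nf
    _ ≤ Real.exp (1 + m * (-(1 / 2))) := Real.exp_le_exp.2 (by linarith)
    _ = Real.exp 1 * Real.exp (-(1 / 2)) ^ m := by rw [Real.exp_add, Real.exp_nat_mul]
    _ ≤ 3 * Real.exp (-(1 / 2)) ^ m := by
        gcongr
        exact Real.exp_one_lt_three.le

end TailEstimates

namespace lbGraph

theorem five_mul_sq_le_lbNumEdges {n m : ℕ} (hn : n ≠ 0) (hm : m ≠ 0) :
    5 * m ^ 2 ≤ lbNumEdges n m m m := by
  have hm3 : m ^ 2 ≤ m ^ 3 := Nat.pow_le_pow_right (Nat.pos_of_ne_zero hm) (by norm_num)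
  calc 5 * m ^ 2 ≤ 2 * (m * m) + 2 * (m * m * m) + m * m + 3 * m := by nlinarith
    _ ≤ lbNumEdges n m m m := by
      rw [lbNumEdges_eq]
      exact Nat.le_mul_of_pos_left _ (Nat.pos_of_ne_zero hn)

open Classical in
theorem dens_not_wellOrdered_le_exp {n m M : ℕ} (hm : m ≠ 0) (hM : 5 * m ^ 2 ≤ M) :
    ((Finset.dens {σ : LBEdge n m m m ≃ Fin M |
      ¬ WellOrdered (fun e => σ e) (M / (2 * m)) (M / 2)} : ℚ≥0) : ℝ) ≤
        11 * m ^ 2 * n * Real.exp (-(1 / 2)) ^ m := by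
  have hm1 : (1 : ℝ) ≤ m := by exact_mod_cast Nat.one_le_iff_ne_zero.2 hm
  have hM5 : 5 ≤ M := le_trans (by nlinarith [Nat.pos_of_ne_zero hm]) hM
  set x := Real.exp (-(1 / 2))
  refine ((NNRat.cast_le (K := ℝ)).2 (dens_not_wellOrdered_le (M / (2 * m)) (M / 2))).trans ?_
  simp only [LBBundle.card_eq, NNRat.cast_add, NNRat.cast_mul, NNRat.cast_pow, NNRat.cast_div,
    NNRat.cast_natCast, NNRat.cast_ofNat, Nat.cast_mul, Nat.cast_add, Nat.cast_ofNat]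
  calc _ ≤ n * (2 * (m * m) + m + 3) * x ^ m + n * m * x ^ m + n * (3 * x ^ m) + n * x ^ m := by
        rw [mul_assoc (n : ℝ) ((m : ℝ) ^ m)]
        gcongr
        · exact half_div_le_exp_neg_half M
        · exact sub_half_div_le_exp_neg_half hM5
        · exact sub_div_two_mul_div_pow_le_exp hm (le_trans (by omega) hM)
        · exact div_two_mul_div_pow_le_exp M m
    _ = (2 * m ^ 2 + 2 * m + 7) * (n * x ^ m) := by ring
    _ ≤ 11 * m ^ 2 * (n * x ^ m) := by
        gcongr
        nlinarith
    _ = 11 * m ^ 2 * n * x ^ m := by ring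

end lbGraph

theorem pow_le_choose_div_factorial {c k n : ℕ} (h : c * k ^ 2 ≤ n + 1 - k) :
    (c : ℝ) ^ k ≤ n.choose k / k.factorial := by
  have hfac : (0 : ℝ) < k.factorial := by exact_mod_cast k.factorial_pos
  have hfac_le : (k.factorial : ℝ) ≤ (k : ℝ) ^ k := by exact_mod_cast Nat.factorial_le_pow k
  rw [le_div_iff₀ hfac]
  refine le_trans ((le_div_iff₀ hfac).2 ?_) (Nat.pow_le_choose k n)
  calc (c : ℝ) ^ k * k.factorial * k.factorial ≤ c ^ k * (k : ℝ) ^ k * (k : ℝ) ^ k := by gcongr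
    _ = (c * (k : ℝ) ^ 2) ^ k := by ring
    _ ≤ ((n + 1 - k : ℕ) : ℝ) ^ k := by
      gcongr
      exact_mod_cast h

theorem exists_two_mul_exp_sqrt_le_choose_div_factorial {n : ℕ} (hn : 64 ≤ n) :
    ∃ k ≠ 0, 2 * Real.exp (1 / 4 * Real.sqrt n) ≤ n.choose k / k.factorial := by
  set q := Real.sqrt n
  have hqq : q ^ 2 = n := Real.sq_sqrt n.cast_nonneg
  have hq8 : 8 ≤ q := Real.le_sqrt_of_sq_le (by norm_num; exact_mod_cast hn)
  have hk_le : (⌊q / 2⌋₊ : ℝ) ≤ q / 2 := Nat.floor_le (by linarith)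
  have hk_gt : q / 2 < ⌊q / 2⌋₊ + 1 := Nat.lt_floor_add_one _
  have hk : 3 * ⌊q / 2⌋₊ ^ 2 + ⌊q / 2⌋₊ ≤ n := by
    have hkR : 3 * (⌊q / 2⌋₊ : ℝ) ^ 2 + ⌊q / 2⌋₊ ≤ n := by nlinarith
    exact_mod_cast hkR
  refine ⟨⌊q / 2⌋₊, (Nat.floor_pos.2 (by linarith)).ne', ?_⟩
  calc 2 * Real.exp (1 / 4 * q) ≤ Real.exp 1 * Real.exp (1 / 4 * q) := by
        gcongr
        exact Real.exp_one_gt_two.le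
    _ = Real.exp (1 + 1 / 4 * q) := (Real.exp_add _ _).symm
    _ ≤ Real.exp (⌊q / 2⌋₊ * 1) := Real.exp_le_exp.2 (by linarith)
    _ = Real.exp 1 ^ ⌊q / 2⌋₊ := Real.exp_nat_mul _ _
    _ ≤ 3 ^ ⌊q / 2⌋₊ := by
        gcongr
        exact Real.exp_one_lt_three.le
    _ ≤ n.choose ⌊q / 2⌋₊ / (⌊q / 2⌋₊).factorial :=
        pow_le_choose_div_factorial (c := 3) (by omega)

theorem isTheta_log_of_le_of_le_sq {α : Type*} {l : Filter α} {f g : α → ℝ}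
    (hf : ∀ᶠ x in l, 1 ≤ f x) (hfg : ∀ᶠ x in l, f x ≤ g x) (hgf : ∀ᶠ x in l, g x ≤ f x ^ 2) :
    (fun x => Real.log (g x)) =Θ[l] fun x => Real.log (f x) := by
  have hlog : ∀ᶠ x in l, 0 ≤ Real.log (f x) ∧ Real.log (f x) ≤ Real.log (g x) ∧
      Real.log (g x) ≤ 2 * Real.log (f x) := by
    filter_upwards [hf, hfg, hgf] with x hf hfg hgf
    refine ⟨Real.log_nonneg hf, Real.log_le_log (by linarith) hfg, ?_⟩
    exact (Real.log_le_log (by linarith) hgf).trans_eq (by simp)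
  constructor
  · refine IsBigO.of_bound 2 (hlog.mono fun x ⟨h₀, h₁, h₂⟩ => ?_)
    rwa [Real.norm_of_nonneg (h₀.trans h₁), Real.norm_of_nonneg h₀]
  · refine IsBigO.of_bound 1 (hlog.mono fun x ⟨h₀, h₁, _⟩ => ?_)
    rwa [Real.norm_of_nonneg (h₀.trans h₁), Real.norm_of_nonneg h₀, one_mul]

namespace lbGraph

variable {ρ : ℕ → ℕ}

theorem mul_cube_le_lbNumEdges (n m : ℕ) : n * m ^ 3 ≤ lbNumEdges n m m m := by
  rw [lbNumEdges_eq]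
  gcongr
  nlinarith

theorem lbNumEdges_le_mul_cube (n m : ℕ) : lbNumEdges n m m m ≤ 8 * (n * m ^ 3) := by
  have hm : m * m ≤ m ^ 3 ∧ m ≤ m ^ 3 := by
    rcases m.eq_zero_or_pos with rfl | hm
    · simp
    · exact ⟨(sq m).symm.trans_le (Nat.pow_le_pow_right hm (by norm_num)),
        Nat.le_self_pow (by norm_num) m⟩
  calc lbNumEdges n m m m = n * (2 * (m * m) + 2 * (m * m * m) + m * m + 3 * m) :=
        lbNumEdges_eq n m m m
    _ ≤ n * (8 * m ^ 3) := by
        gcongr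
        linarith [(by ring : m * m * m = m ^ 3)]
    _ = 8 * (n * m ^ 3) := by ring

theorem isTheta_lbNumEdges (hρ : (fun n => (ρ n : ℝ)) =Θ[atTop] fun n : ℕ => Real.log n) :
    (fun n => (lbNumEdges n (ρ n) (ρ n) (ρ n) : ℝ)) =Θ[atTop] fun n : ℕ => n * Real.log n ^ 3 := by
  have hM : (fun n => (lbNumEdges n (ρ n) (ρ n) (ρ n) : ℝ)) =Θ[atTop]
      fun n => (n * (ρ n) ^ 3 : ℝ) := by
    refine ⟨IsBigO.of_bound 8 (.of_forall fun n => ?_), IsBigO.of_bound 1 (.of_forall fun n => ?_)⟩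
    · rw [Real.norm_of_nonneg (by positivity), Real.norm_of_nonneg (by positivity)]
      exact_mod_cast lbNumEdges_le_mul_cube n (ρ n)
    · rw [Real.norm_of_nonneg (by positivity), Real.norm_of_nonneg (by positivity), one_mul]
      exact_mod_cast mul_cube_le_lbNumEdges n (ρ n)
  exact hM.trans ((isTheta_refl _ _).mul (hρ.pow 3))

theorem isTheta_log_lbNumEdges (hρ : (fun n => (ρ n : ℝ)) =Θ[atTop] fun n : ℕ => Real.log n) :
    (fun n => Real.log (lbNumEdges n (ρ n) (ρ n) (ρ n))) =Θ[atTop] fun n : ℕ => Real.log n := by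
  have hlog : Tendsto (fun n : ℕ => Real.log n) atTop atTop :=
    Real.tendsto_log_atTop.comp tendsto_natCast_atTop_atTop
  have hlog_pow : (fun n : ℕ => Real.log n ^ 3) =o[atTop] fun n : ℕ => (n : ℝ) :=
    Real.isLittleO_pow_log_id_atTop.comp_tendsto tendsto_natCast_atTop_atTop
  have hle : (fun n : ℕ => (n : ℝ)) =o[atTop]
      fun n => (lbNumEdges n (ρ n) (ρ n) (ρ n) : ℝ) := by
    have hone : (fun _ : ℕ => (1 : ℝ)) =o[atTop] fun n : ℕ => Real.log n ^ 3 :=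
      isLittleO_const_left.2 (.inr (tendsto_norm_atTop_atTop.comp
        ((tendsto_pow_atTop (by norm_num)).comp hlog)))
    simpa only [mul_one] using
      ((isBigO_refl _ _).mul_isLittleO hone).trans_isTheta (isTheta_lbNumEdges hρ).symm
  have hge : (fun n => (lbNumEdges n (ρ n) (ρ n) (ρ n) : ℝ)) =o[atTop]
      fun n : ℕ => (n : ℝ) ^ 2 := by
    simpa only [sq] using
      (isTheta_lbNumEdges hρ).trans_isLittleO ((isBigO_refl _ _).mul_isLittleO hlog_pow)
  refine isTheta_log_of_le_of_le_sq ((eventually_ge_atTop 1).mono fun n hn => by exact_mod_cast hn)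
    ?_ ?_
  · simpa using hle.bound one_pos
  · simpa using hge.bound one_pos

theorem isTheta_sqrt_lbNumEdges (hρ : (fun n => (ρ n : ℝ)) =Θ[atTop] fun n : ℕ => Real.log n) :
    (fun n : ℕ => Real.sqrt n) =Θ[atTop] fun n : ℕ =>
      Real.sqrt (lbNumEdges n (ρ n) (ρ n) (ρ n)) /
        Real.log (lbNumEdges n (ρ n) (ρ n) (ρ n)) ^ (3 / 2 : ℝ) := by
  have hM : (fun n => (lbNumEdges n (ρ n) (ρ n) (ρ n) /
      Real.log (lbNumEdges n (ρ n) (ρ n) (ρ n)) ^ 3 : ℝ)) =Θ[atTop] fun n : ℕ => (n : ℝ) := by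
    refine ((isTheta_lbNumEdges hρ).div ((isTheta_log_lbNumEdges hρ).pow 3)).trans_eventuallyEq ?_
    filter_upwards [eventually_gt_atTop 1] with n hn
    have hlog : 0 < Real.log n := Real.log_pos (by exact_mod_cast hn)
    exact mul_div_cancel_right₀ _ (pow_pos hlog 3).ne'
  have hsqrt := (hM.rpow (r := 1 / 2)
    (.of_forall fun n => div_nonneg (Nat.cast_nonneg _) (pow_nonneg (Real.log_natCast_nonneg _) 3))
    (.of_forall fun n => n.cast_nonneg)).symm
  simp only [← Real.sqrt_eq_rpow] at hsqrt
  refine hsqrt.trans_eventuallyEq (.of_forall fun n => ?_)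
  have hlog := Real.log_natCast_nonneg (lbNumEdges n (ρ n) (ρ n) (ρ n))
  beta_reduce
  rw [Real.sqrt_div (Nat.cast_nonneg _), Real.sqrt_eq_rpow (_ ^ 3), ← Real.rpow_natCast,
    ← Real.rpow_mul hlog]
  norm_num

theorem eventually_three_mul_log_le (hρ_lower : ∀ᶠ n : ℕ in atTop, 3 * ⌈Real.log n⌉₊ ≤ ρ n) :
    ∀ᶠ n : ℕ in atTop, 3 * Real.log n ≤ ρ n := by
  filter_upwards [hρ_lower] with n hn
  calc 3 * Real.log n ≤ 3 * ⌈Real.log n⌉₊ := by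
        gcongr
        exact Nat.le_ceil _
    _ ≤ ρ n := by exact_mod_cast hn

theorem tendsto_atTop_of_three_mul_log_le (hρ : ∀ᶠ n : ℕ in atTop, 3 * Real.log n ≤ ρ n) :
    Tendsto ρ atTop atTop :=
  tendsto_natCast_atTop_iff.1 <| tendsto_atTop_mono' _ hρ <|
    (Real.tendsto_log_atTop.comp tendsto_natCast_atTop_atTop).const_mul_atTop three_pos

theorem eventually_mul_exp_neg_half_pow_le (hρ : ∀ᶠ n : ℕ in atTop, 3 * Real.log n ≤ ρ n) :
    ∀ᶠ n : ℕ in atTop, 11 * (ρ n : ℝ) ^ 2 * n * Real.exp (-(1 / 2)) ^ ρ n ≤ 1 / 2 := by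
  have hρ_top : Tendsto (fun n => (ρ n : ℝ) / 6) atTop atTop :=
    (tendsto_natCast_atTop_atTop.comp (tendsto_atTop_of_three_mul_log_le hρ)).atTop_div_const
      (by norm_num)
  have hlim := ((Real.tendsto_pow_mul_exp_neg_atTop_nhds_zero 2).comp hρ_top).const_mul 396
  rw [mul_zero] at hlim
  filter_upwards [hρ, eventually_gt_atTop 0, hlim.eventually_le_const one_half_pos]
    with n hle hn hsmall
  have hn_le : (n : ℝ) ≤ Real.exp (ρ n / 3) :=
    (Real.log_le_iff_le_exp (by exact_mod_cast hn)).1 (by linarith)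
  calc 11 * (ρ n : ℝ) ^ 2 * n * Real.exp (-(1 / 2)) ^ ρ n
      ≤ 11 * (ρ n : ℝ) ^ 2 * Real.exp (ρ n / 3) * Real.exp (-(1 / 2)) ^ ρ n := by gcongr
    _ = 396 * ((ρ n / 6 : ℝ) ^ 2 * Real.exp (-(ρ n / 6))) := by
        rw [← Real.exp_nat_mul, mul_assoc, ← Real.exp_add]
        ring_nf
    _ ≤ 1 / 2 := hsmall

open Classical in
theorem eventually_half_le_dens_wellOrdered (hρ : ∀ᶠ n : ℕ in atTop, 3 * Real.log n ≤ ρ n) :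
    ∀ᶠ n : ℕ in atTop, 1 / 2 ≤ ((Finset.dens
      {σ : LBEdge n (ρ n) (ρ n) (ρ n) ≃ Fin (lbNumEdges n (ρ n) (ρ n) (ρ n)) |
        WellOrdered (fun e => σ e) (lbNumEdges n (ρ n) (ρ n) (ρ n) / (2 * ρ n))
          (lbNumEdges n (ρ n) (ρ n) (ρ n) / 2)} : ℚ≥0) : ℝ) := by
  filter_upwards [eventually_mul_exp_neg_half_pow_le hρ, eventually_ne_atTop 0,
    (tendsto_atTop_of_three_mul_log_le hρ).eventually_ne_atTop 0] with n hsmall hn hρn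
  have hnot := (dens_not_wellOrdered_le_exp hρn (five_mul_sq_le_lbNumEdges hn hρn)).trans hsmall
  have : Nonempty (LBEdge n (ρ n) (ρ n) (ρ n) ≃ Fin (lbNumEdges n (ρ n) (ρ n) (ρ n))) :=
    ⟨Fintype.equivFin _⟩
  have hsum := congrArg (NNRat.cast : ℚ≥0 → ℝ) (Finset.dens_filter_add_dens_filter_not_eq_dens
    (s := Finset.univ) fun σ : LBEdge n (ρ n) (ρ n) (ρ n) ≃ Fin (lbNumEdges n (ρ n) (ρ n) (ρ n)) =>
      WellOrdered (fun e => σ e) (lbNumEdges n (ρ n) (ρ n) (ρ n) / (2 * ρ n))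
        (lbNumEdges n (ρ n) (ρ n) (ρ n) / 2))
  rw [NNRat.cast_add, Finset.dens_univ, NNRat.cast_one] at hsum
  linarith

theorem eventually_exp_sqrt_le_expectedSwitches
    (hρ : ∀ᶠ n : ℕ in atTop, 3 * Real.log n ≤ ρ n) :
    ∀ᶠ n : ℕ in atTop, ∀ B₀ : Finset (LBEdge n (ρ n) (ρ n) (ρ n)),
      (lbGraph n (ρ n) (ρ n) (ρ n)).IsTree B₀ → (∀ e ∈ B₀, e.IsZeroEdge) →
        Real.exp (1 / 4 * Real.sqrt n) ≤ (lbGraph n (ρ n) (ρ n) (ρ n)).expectedSwitches B₀ := by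
  classical
  filter_upwards [eventually_half_le_dens_wellOrdered hρ, eventually_ge_atTop 64,
    (tendsto_atTop_of_three_mul_log_le hρ).eventually_gt_atTop 0] with n hdens hn hρn B₀ hB₀ hzero
  obtain ⟨k, hk, hexp⟩ := exists_two_mul_exp_sqrt_le_choose_div_factorial hn
  calc Real.exp (1 / 4 * Real.sqrt n)
      = 2 * Real.exp (1 / 4 * Real.sqrt n) * (1 / 2) := by ring
    _ ≤ _ := mul_le_mul hexp hdens (by norm_num) (by positivity)
    _ ≤ _ := choose_div_factorial_mul_le_expectedSwitches (by positivity) hk _ _ hB₀ hzero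

end lbGraph

theorem mainTheorem2 (ρ : ℕ → ℕ)
    (hρ : (fun n => (ρ n : ℝ)) =Θ[atTop] fun n : ℕ => Real.log n)
    (hρ_lower : ∀ᶠ n : ℕ in atTop, 3 * ⌈Real.log n⌉₊ ≤ ρ n) :
    ((fun n : ℕ => Real.sqrt n) =Θ[atTop] fun n : ℕ =>
      Real.sqrt (lbNumEdges n (ρ n) (ρ n) (ρ n)) /
        Real.log (lbNumEdges n (ρ n) (ρ n) (ρ n)) ^ (3 / 2 : ℝ)) ∧
    ∃ c : ℝ, 0 < c ∧ ∀ᶠ n : ℕ in atTop,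
      ∀ B₀ : Finset (LBEdge n (ρ n) (ρ n) (ρ n)),
        (lbGraph n (ρ n) (ρ n) (ρ n)).IsTree B₀ → (∀ e ∈ B₀, e.IsZeroEdge) →
        Real.exp (c * Real.sqrt n) ≤
            (lbGraph n (ρ n) (ρ n) (ρ n)).expectedSwitches B₀ ∧
        Real.exp (c * (Real.sqrt (lbNumEdges n (ρ n) (ρ n) (ρ n)) /
              Real.log (lbNumEdges n (ρ n) (ρ n) (ρ n)) ^ (3 / 2 : ℝ))) ≤
            (lbGraph n (ρ n) (ρ n) (ρ n)).expectedSwitches B₀ := by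
  have hlog := lbGraph.eventually_three_mul_log_le hρ_lower
  have hΘ := lbGraph.isTheta_sqrt_lbNumEdges hρ
  obtain ⟨C, hC, hM⟩ := hΘ.2.exists_pos
  refine ⟨hΘ, min (1 / 4) (1 / (4 * C)), by positivity, ?_⟩
  filter_upwards [lbGraph.eventually_exp_sqrt_le_expectedSwitches hlog, hM.bound]
    with n hswitches hM B₀ hB₀ hzero
  refine ⟨le_trans (Real.exp_le_exp.2 ?_) (hswitches B₀ hB₀ hzero),
    le_trans (Real.exp_le_exp.2 ?_) (hswitches B₀ hB₀ hzero)⟩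
  · exact mul_le_mul_of_nonneg_right (min_le_left _ _) (Real.sqrt_nonneg _)
  · rw [Real.norm_of_nonneg (Real.sqrt_nonneg n)] at hM
    calc _ ≤ 1 / (4 * C) * (C * Real.sqrt n) :=
          mul_le_mul (min_le_right _ _) ((Real.le_norm_self _).trans hM)
            (div_nonneg (Real.sqrt_nonneg _)
              (Real.rpow_nonneg (Real.log_natCast_nonneg _) _)) (by positivity)
      _ = 1 / 4 * Real.sqrt n := by field_simp
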